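/- **Solution Independence.** Fix a function-free first-order signature with set of predicate symbols $\mathbf P$ and set of constants $\Delta$. Formulae are built from atoms $P(t_1,\dots,t_m)$ by $\lnot,\land,\exists$ and the modalities $\mathbf K,\mathbf{not}$ (no equality, no truth constants); $\mathrm{pr}(\cdot)$ is the set of predicate symbols that occur. An interpretation is a set of ground atoms, $\mathcal I$ is the set of all of them, and an MKNF interpretation is a nonempty subset of $\mathcal I$. For $I\in\mathcal I$, $M,N\subseteq\mathcal I$: $(I,M,N)\models p$ iff $p\in I$ for ground atoms $p$; $\lnot,\land$ are as usual; $\exists x\,\phi$ holds iff $\phi[c/x]$ holds for some $c\in\Delta$; $(I,M,N)\models\mathbf K\phi$ iff $(J,M,N)\models\phi$ for all $J\in M$; $(I,M,N)\models\mathbf{not}\,\phi$ iff $(J,M,N)\not\models\phi$ for some $J\in N$. For a set $T$ of sentences, $M\models T$ means $(I,M,M)\models\phi$ for all $\phi\in T$, $I\in M$; for a first-order theory $T$, $\mathsf{mod}(T)$ is the greatest $M\subseteq\mathcal I$ with $M\models T$. *Knowledge bases.* A literal $L$ is a ground atom $p$ or a default literal $\sim p$, with $\sim\sim p=p$, $\pi(p)=\mathbf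 Kp$, $\pi(\sim p)=\mathbf{not}\,p$. A rule $r$ has a literal $H(r)$ as head and a finite set $B(r)$ of literals as body; it is positive if $H(r)$ is an atom and a fact if $B(r)=\emptyset$. A hybrid knowledge base is a pair $\mathcal K=\langle\mathcal O,\mathcal P\rangle$ of a set $\mathcal O$ of axioms of a description logic, each axiom $\phi$ having a translation $\kappa(\phi)$ into a first-order sentence and $\mathrm{pr}(\phi)=\mathrm{pr}(\kappa(\phi))$, and a set $\mathcal P$ of rules. A dynamic hybrid knowledge base is a finite sequence $\mathcal K=\langle\mathcal K_i\rangle_{i<n}$, $\mathcal K_i=\langle\mathcal O_i,\mathcal P_i\rangle$; operations on hybrid knowledge bases are applied to it componentwise. *Basic updates.* For a predicate symbol $P$ let $\mathrm{diff}(P,I,J)$ be the set of ground atoms with predicate symbol $P$ that lie in exactly one of $I,J$. Write $J\le_I J'$ if $\mathrm{diff}(P,I,J)\subseteq\mathrm{diff}(P,I,J')$ for all $P$, and $J<_IJ'$ if $J\le_IJ'$ and not $J'\le_IJ$. Put $M\oplus N=\bigcup_{I\in M}\{J\in N: \text{there is no } J'\in N \text{ with } J'<_IJ\}$. The minimal change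 update model of first-order theories $\langle T_i\rangle_{i<n}$ is $(\cdots(\mathcal I\oplus\mathsf{mod}(T_0))\oplus\cdots)\oplus\mathsf{mod}(T_{n-1})$, provided that it is nonempty. An interpretation $I$ is a dynamic stable model of programs $\langle\mathcal P_i\rangle_{i<n}$ if $I\cup\{\sim p: p\notin I\}$ is the least model, with each $\sim p$ read as a fresh atom, of the program that consists of all $r$ that have an unrejected occurrence $r\in\mathcal P_i$ for some $i$, where this occurrence is rejected if some $r'\in\mathcal P_j$ with $i\le j$ satisfies $H(r)=\,\sim H(r')$ and $I\models B(r')$, together with the facts $\sim p$ for all ground atoms $p$ such that no rule $r$ of any $\mathcal P_i$ has $H(r)=p$ and $I\models B(r)$. An MKNF interpretation $M$ is a dynamic MKNF model of a basic $\mathcal K$ if either all rules of all $\mathcal P_i$ are positive facts and $M$ is the minimal change update model of $\langle\kappa(\mathcal O_i)\cup\mathcal P_i\rangle_{i<n}$, or all $\mathcal O_i$ are empty and $M=\{J\in\mathcal I: I\subseteq J\}$ for a dynamic stable model $I$ of $\langle\mathcal P_i\rangle_{i<n}$. *Splitting.* $U\subseteq\mathbf P$ is a splitting set for $\langle\mathcal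 O,\mathcal P\rangle$ if every $\phi\in\mathcal O$ with $\mathrm{pr}(\phi)\cap U\ne\emptyset$ has $\mathrm{pr}(\phi)\subseteq U$ and every $r\in\mathcal P$ with $\mathrm{pr}(H(r))\cap U\neq\emptyset$ has $\mathrm{pr}(r)\subseteq U$. The bottom $b_U$ keeps the axioms and rules with all predicate symbols in $U$, and the top $t_U$ keeps the others. For $X\subseteq\mathcal I$, the reduct $e_U(\langle\mathcal O,\mathcal P\rangle,X)$ consists of $t_U(\mathcal O)$ and of all rules $H(r)\leftarrow\{L\in B(r):\mathrm{pr}(L)\subseteq\mathbf P\setminus U\}$ with $r\in t_U(\mathcal P)$ and $X\models\pi(\{L\in B(r):\mathrm{pr}(L)\subseteq U\})$. A splitting sequence for a hybrid knowledge base is a transfinite sequence $U=\langle U_\alpha\rangle_{\alpha<\mu}$ of splitting sets that is monotone and continuous ($U_\alpha=\bigcup_{\eta<\alpha}U_\eta$ at limit ordinals $\alpha<\mu$) with $\bigcup_{\alpha<\mu}U_\alpha=\mathbf P$; it is one for a dynamic $\mathcal K$ if it is one for every $\mathcal K_i$. A dynamic $\mathcal K$ is reducible relative to $W\subseteq\mathbf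 P$ if either all its rules $r$ are positive with $\mathrm{pr}(B(r))\subseteq W$, or all its ontologies are empty. A splitting sequence $U$ is update-enabling for $\mathcal K$ if $b_{U_0}(\mathcal K)$ is reducible relative to $\emptyset$ and, whenever $\alpha+1<\mu$, $t_{U_\alpha}(b_{U_{\alpha+1}}(\mathcal K))$ is reducible relative to $U_\alpha$. $\mathcal K$ is updatable if it has an update-enabling splitting sequence. *Models.* An MKNF interpretation $M$ is a dynamic MKNF model of $\mathcal K$ with respect to $U$ if $M=\bigcap_{\alpha<\mu}X_\alpha$ for some MKNF interpretations $\langle X_\alpha\rangle_{\alpha<\mu}$ such that $X_0$ is a dynamic MKNF model of the basic $b_{U_0}(\mathcal K)$; $X_{\alpha+1}$ is a dynamic MKNF model of the basic $e_{U_\alpha}(b_{U_{\alpha+1}}(\mathcal K),\bigcap_{\eta\le\alpha}X_\eta)$ whenever $\alpha+1<\mu$; and $X_\alpha=\mathcal I$ for limit ordinals $\alpha<\mu$. $M$ is a dynamic MKNF model of an updatable $\mathcal K$ if it is one with respect to some update-enabling splitting sequence for $\mathcal K$. **Proposition.** Let $U,V$ be update-enabling splitting sequences for a dynamic hybrid knowledge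 base $\mathcal K$. Then for every $M$: $M$ is a dynamic MKNF model of $\mathcal K$ with respect to $U$ if and only if $M$ is a dynamic MKNF model of $\mathcal K$ with respect to $V$. Consequently, the dynamic MKNF models of $\mathcal K$ are exactly its dynamic MKNF models with respect to $U$. -/

import Mathlib

universe u v w o o'

namespace HybridMKNF

/-- A function-free first-order signature: predicate symbols with arities, and constants.
By the standard names assumption the Herbrand universe is the set of constants. -/
structure Signature where
  Pred : Type u
  arity : Pred → ℕ
  Const : Type v

variable {σ : Signature.{u, v}}

/-! ### MKNF formulae -/

/-- Terms whose free variables are among `n` given ones. -/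
inductive Term (σ : Signature.{u, v}) (n : ℕ) : Type v
  | const (c : σ.Const) : Term σ n
  | var (i : Fin n) : Term σ n

/-- MKNF formulae whose free variables are among `n` given ones;
`ex` binds the last variable, `know` is the modality **K**, `naf` the modality **not**. -/
inductive Formula (σ : Signature.{u, v}) : ℕ → Type (max u v)
  | atom {n : ℕ} (P : σ.Pred) (t : Fin (σ.arity P) → Term σ n) : Formula σ n
  | neg {n : ℕ} (φ : Formula σ n) : Formula σ n
  | conj {n : ℕ} (φ ψ : Formula σ n) : Formula σ n
  | ex {n : ℕ} (φ : Formula σ (n + 1)) : Formula σ n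
  | know {n : ℕ} (φ : Formula σ n) : Formula σ n
  | naf {n : ℕ} (φ : Formula σ n) : Formula σ n

abbrev Sentence (σ : Signature.{u, v}) := Formula σ 0

/-- The set of predicate symbols relevant to a formula. -/
def Formula.preds : {n : ℕ} → Formula σ n → Set σ.Pred
  | _, .atom P _ => {P}
  | _, .neg φ => φ.preds
  | _, .conj φ ψ => φ.preds ∪ ψ.preds
  | _, .ex φ => φ.preds
  | _, .know φ => φ.preds
  | _, .naf φ => φ.preds

/-- A formula is first-order if it contains no modal operator. -/
def Formula.IsFirstOrder : {n : ℕ} → Formula σ n → Prop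
  | _, .atom _ _ => True
  | _, .neg φ => φ.IsFirstOrder
  | _, .conj φ ψ => φ.IsFirstOrder ∧ ψ.IsFirstOrder
  | _, .ex φ => φ.IsFirstOrder
  | _, .know _ => False
  | _, .naf _ => False

/-- First-order sentences. -/
def FOSentence (σ : Signature.{u, v}) := {φ : Sentence σ // φ.IsFirstOrder}

/-! ### Herbrand interpretations and MKNF satisfaction -/

/-- Ground atoms. -/
structure GroundAtom (σ : Signature.{u, v}) where
  pred : σ.Pred
  args : Fin (σ.arity pred) → σ.Const

/-- A Herbrand interpretation is a set of ground atoms. -/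
abbrev Interp (σ : Signature.{u, v}) := Set (GroundAtom σ)

/-- A ground atom as a first-order sentence. -/
def GroundAtom.toSentence (p : GroundAtom σ) : Sentence σ :=
  .atom p.pred fun i => .const (p.args i)

def Term.eval {n : ℕ} (e : Fin n → σ.Const) : Term σ n → σ.Const
  | .const c => c
  | .var i => e i

/-- Satisfaction of a formula in the MKNF structure `(I, M, N)`, the free variables being replaced
by the constants that `e` assigns to them. -/
def Formula.Sat : {n : ℕ} → Formula σ n → (Fin n → σ.Const) →
    Interp σ → Set (Interp σ) → Set (Interp σ) → Prop
  | _, .atom P t, e, I, _, _ => (⟨P, fun i => (t i).eval e⟩ : GroundAtom σ) ∈ I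
  | _, .neg φ, e, I, M, N => ¬ φ.Sat e I M N
  | _, .conj φ ψ, e, I, M, N => φ.Sat e I M N ∧ ψ.Sat e I M N
  | _, .ex φ, e, I, M, N => ∃ c : σ.Const, φ.Sat (Fin.snoc e c) I M N
  | _, .know φ, e, _, M, N => ∀ J ∈ M, φ.Sat e J M N
  | _, .naf φ, e, _, M, N => ∃ J ∈ N, ¬ φ.Sat e J M N

/-- `M ⊨ T` for a set of interpretations `M` (possibly empty) and a set of sentences `T`. -/
def Models (M : Set (Interp σ)) (T : Set (Sentence σ)) : Prop :=
  ∀ φ ∈ T, ∀ I ∈ M, φ.Sat Fin.elim0 I M M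

/-- The greatest set of interpretations `M` with `M ⊨ T`. It is only used for first-order
theories `T`, where the union below is itself such a set: see `isGreatest_mod`. -/
def mod (T : Set (Sentence σ)) : Set (Interp σ) := ⋃₀ {M | Models M T}

theorem Formula.IsFirstOrder.sat_iff {n : ℕ} {φ : Formula σ n} (h : φ.IsFirstOrder)
    (e : Fin n → σ.Const) (I : Interp σ) (M N M' N' : Set (Interp σ)) :
    φ.Sat e I M N ↔ φ.Sat e I M' N' := by
  induction φ with
  | atom P t => exact Iff.rfl
  | neg φ ih => exact not_congr (ih h e)
  | conj φ ψ ih₁ ih₂ => exact and_congr (ih₁ h.1 e) (ih₂ h.2 e)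
  | ex φ ih => exact exists_congr fun c => ih h (Fin.snoc e c)
  | know φ ih => exact h.elim
  | naf φ ih => exact h.elim

theorem isGreatest_mod {T : Set (Sentence σ)} (hT : ∀ φ ∈ T, φ.IsFirstOrder) :
    IsGreatest {M | Models M T} (mod T) := by
  refine ⟨?_, fun M hM => Set.subset_sUnion_of_mem hM⟩
  rintro φ hφ I ⟨M, hM, hI⟩
  exact ((hT φ hφ).sat_iff _ I M M _ _).1 (hM φ hφ I hI)

/-! ### Rules, ontologies and hybrid knowledge bases -/

/-- Literals: ground atoms and default literals. -/
inductive Literal (σ : Signature.{u, v})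
  | pos (p : GroundAtom σ) : Literal σ
  | dneg (p : GroundAtom σ) : Literal σ

/-- Default negation of a literal; double default negation is absorbed. -/
def Literal.compl : Literal σ → Literal σ
  | .pos p => .dneg p
  | .dneg p => .pos p

def Literal.preds : Literal σ → Set σ.Pred
  | .pos p => {p.pred}
  | .dneg p => {p.pred}

/-- The MKNF translation `π(L)` of a literal. -/
def Literal.toMKNF : Literal σ → Sentence σ
  | .pos p => .know p.toSentence
  | .dneg p => .naf p.toSentence

/-- Satisfaction of a literal in a Herbrand interpretation. -/
def Literal.Holds (I : Interp σ) : Literal σ → Prop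
  | .pos p => p ∈ I
  | .dneg p => p ∉ I

/-- A ground rule `L₀ ← L₁, …, L_k`. -/
structure Rule (σ : Signature.{u, v}) where
  head : Literal σ
  body : Finset (Literal σ)

def Rule.bodyPreds (r : Rule σ) : Set σ.Pred := ⋃ L ∈ r.body, L.preds

def Rule.preds (r : Rule σ) : Set σ.Pred := r.head.preds ∪ r.bodyPreds

def Rule.IsPositive (r : Rule σ) : Prop := ∃ p, r.head = .pos p

def Rule.IsFact (r : Rule σ) : Prop := r.body = ∅

def Rule.BodyHolds (I : Interp σ) (r : Rule σ) : Prop := ∀ L ∈ r.body, L.Holds I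

/-- A description logic: a type of ontology axioms with a translation of them into function-free
first-order sentences. -/
structure DescriptionLogic (σ : Signature.{u, v}) where
  Ax : Type w
  fo : Ax → FOSentence σ

variable {L : DescriptionLogic.{u, v, w} σ}

def DescriptionLogic.preds (L : DescriptionLogic.{u, v, w} σ) (a : L.Ax) : Set σ.Pred :=
  (L.fo a).1.preds

/-- A hybrid knowledge base: an ontology and a generalised logic program. -/
structure HybridKB (L : DescriptionLogic.{u, v, w} σ) where
  ont : Set L.Ax
  prog : Set (Rule σ)

/-- A dynamic hybrid knowledge base of length `n`. -/
abbrev DynamicKB (L : DescriptionLogic.{u, v, w} σ) (n : ℕ) := Fin n → HybridKB L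

/-! ### Minimal change update semantics -/

/-- The ground atoms of `I` with predicate symbol `P`. -/
def restrPred (P : σ.Pred) (I : Interp σ) : Set (GroundAtom σ) := {p ∈ I | p.pred = P}

/-- Difference in the interpretation of `P` between `I` and `J`. -/
def diff (P : σ.Pred) (I J : Interp σ) : Set (GroundAtom σ) :=
  (restrPred P I \ restrPred P J) ∪ (restrPred P J \ restrPred P I)

/-- `J` is at least as close to `I` as `J'`. -/
def CloserEq (I J J' : Interp σ) : Prop := ∀ P : σ.Pred, diff P I J ⊆ diff P I J'

/-- `J` is closer to `I` than `J'`. -/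
def Closer (I J J' : Interp σ) : Prop := CloserEq I J J' ∧ ¬ CloserEq I J' J

/-- `I ⊕ N`. -/
def updateOne (I : Interp σ) (N : Set (Interp σ)) : Set (Interp σ) :=
  {J ∈ N | ¬ ∃ J' ∈ N, Closer I J' J}

/-- `M ⊕ N`. -/
def update (M N : Set (Interp σ)) : Set (Interp σ) := ⋃ I ∈ M, updateOne I N

/-- `(⋯((𝓘 ⊕ M₀) ⊕ M₁) ⊕ ⋯) ⊕ M_{n-1}`, which is the set `𝓘` of all interpretations for `n = 0`. -/
def updateSeq : (n : ℕ) → (Fin n → Set (Interp σ)) → Set (Interp σ)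
  | 0, _ => Set.univ
  | n + 1, M => update (updateSeq n fun i => M i.castSucc) (M (Fin.last n))

/-- `M` is the minimal change update model of the sequence `T` of first-order theories. -/
def IsMinimalChangeModel {n : ℕ} (T : Fin n → Set (Sentence σ)) (M : Set (Interp σ)) : Prop :=
  M.Nonempty ∧ M = updateSeq n fun i => mod (T i)

/-! ### Dynamic stable models -/

/-- The least model of a program whose default literals are read as fresh atoms. -/
def least (Q : Set (Rule σ)) : Set (Literal σ) :=
  ⋂₀ {S | ∀ r ∈ Q, (∀ K ∈ r.body, K ∈ S) → r.head ∈ S}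

/-- The rules left after causal rejection. Rejection concerns occurrences of rules: the occurrence
of `r` in the `i`-th program is rejected by a conflicting rule with true body in the `j`-th
program, `i ≤ j`. -/
def unrejected {n : ℕ} (Q : Fin n → Set (Rule σ)) (I : Interp σ) : Set (Rule σ) :=
  {r | ∃ i, r ∈ Q i ∧
    ¬ ∃ j, i ≤ j ∧ ∃ r' ∈ Q j, r.head = r'.head.compl ∧ r'.BodyHolds I}

/-- The default assumptions, as facts. -/
def defaults {n : ℕ} (Q : Fin n → Set (Rule σ)) (I : Interp σ) : Set (Rule σ) :=
  {r | ∃ p : GroundAtom σ, r = ⟨.dneg p, ∅⟩ ∧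
    ¬ ∃ i, ∃ r' ∈ Q i, r'.head = .pos p ∧ r'.BodyHolds I}

/-- `I` is a dynamic stable model of the dynamic logic program `Q`. -/
def IsDynamicStableModel {n : ℕ} (Q : Fin n → Set (Rule σ)) (I : Interp σ) : Prop :=
  {K : Literal σ | K.Holds I} = least (unrejected Q I ∪ defaults Q I)

/-! ### Dynamic MKNF models of basic dynamic hybrid knowledge bases -/

namespace DynamicKB

variable {n : ℕ}

/-- All programs contain only positive facts. -/
def IsOntBased (kb : DynamicKB L n) : Prop := ∀ i, ∀ r ∈ (kb i).prog, r.IsPositive ∧ r.IsFact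

/-- All ontologies are empty. -/
def IsProgBased (kb : DynamicKB L n) : Prop := ∀ i, (kb i).ont = ∅

/-- The `i`-th first-order theory of an ontology-based dynamic knowledge base: the translated
ontology axioms together with the positive facts, read as ground atoms. -/
def theory (kb : DynamicKB L n) (i : Fin n) : Set (Sentence σ) :=
  {φ | ∃ a ∈ (kb i).ont, φ = (L.fo a).1} ∪
    {φ | ∃ p : GroundAtom σ, (⟨.pos p, ∅⟩ : Rule σ) ∈ (kb i).prog ∧ φ = p.toSentence}

/-- `M` is a dynamic MKNF model of a basic dynamic hybrid knowledge base. -/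
def IsBasicModel (kb : DynamicKB L n) (M : Set (Interp σ)) : Prop :=
  M.Nonempty ∧
    ((kb.IsOntBased ∧ IsMinimalChangeModel kb.theory M) ∨
      (kb.IsProgBased ∧
        ∃ I, IsDynamicStableModel (fun i => (kb i).prog) I ∧ M = {J | I ⊆ J}))

end DynamicKB

/-! ### Splitting sets and reducts -/

namespace HybridKB

/-- `U` is a splitting set for `kb`. -/
def IsSplittingSet (kb : HybridKB L) (U : Set σ.Pred) : Prop :=
  (∀ a ∈ kb.ont, (L.preds a ∩ U).Nonempty → L.preds a ⊆ U) ∧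
    ∀ r ∈ kb.prog, (r.head.preds ∩ U).Nonempty → r.preds ⊆ U

/-- The bottom `b_U(kb)`. -/
def bottom (U : Set σ.Pred) (kb : HybridKB L) : HybridKB L where
  ont := {a ∈ kb.ont | L.preds a ⊆ U}
  prog := {r ∈ kb.prog | r.preds ⊆ U}

/-- The top `t_U(kb)`. -/
def top (U : Set σ.Pred) (kb : HybridKB L) : HybridKB L where
  ont := kb.ont \ (kb.bottom U).ont
  prog := kb.prog \ (kb.bottom U).prog

/-- The splitting set reduct `e_U(kb, X)`. -/
def reduct (U : Set σ.Pred) (kb : HybridKB L) (X : Set (Interp σ)) : HybridKB L where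
  ont := (kb.top U).ont
  prog := {r' | ∃ r ∈ (kb.top U).prog,
    Models X (Literal.toMKNF '' {K | K ∈ r.body ∧ K.preds ⊆ U}) ∧
    r'.head = r.head ∧ ∀ K, K ∈ r'.body ↔ K ∈ r.body ∧ K.preds ⊆ Uᶜ}

end HybridKB

/-- A transfinite sequence `⟨U_α⟩_{α < μ}` of sets of predicate symbols with `μ = length`; the
values `set α` for `α ≥ μ` are irrelevant. -/
structure PredSeq (σ : Signature.{u, v}) where
  length : Ordinal.{o}
  set : Ordinal.{o} → Set σ.Pred

/-- `U` is a splitting sequence for `kb`: a monotone, continuous sequence of splitting sets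
whose union is the set of all predicate symbols. -/
structure HybridKB.IsSplittingSequence (kb : HybridKB L) (U : PredSeq.{u, v, o} σ) : Prop where
  monotone : ∀ α β, α ≤ β → β < U.length → U.set α ⊆ U.set β
  continuous : ∀ α < U.length, Order.IsSuccLimit α → U.set α = ⋃ η < α, U.set η
  splitting : ∀ α < U.length, kb.IsSplittingSet (U.set α)
  union : ⋃ α < U.length, U.set α = Set.univ

/-! ### Updatable dynamic hybrid knowledge bases -/

namespace DynamicKB

variable {n : ℕ}

def bottom (U : Set σ.Pred) (kb : DynamicKB L n) : DynamicKB L n := fun i => (kb i).bottom U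

def top (U : Set σ.Pred) (kb : DynamicKB L n) : DynamicKB L n := fun i => (kb i).top U

def reduct (U : Set σ.Pred) (kb : DynamicKB L n) (X : Set (Interp σ)) : DynamicKB L n :=
  fun i => (kb i).reduct U X

def IsSplittingSequence (kb : DynamicKB L n) (U : PredSeq.{u, v, o} σ) : Prop :=
  ∀ i, (kb i).IsSplittingSequence U

def IsOntReducible (kb : DynamicKB L n) (U : Set σ.Pred) : Prop :=
  ∀ i, ∀ r ∈ (kb i).prog, r.IsPositive ∧ r.bodyPreds ⊆ U

def IsProgReducible (kb : DynamicKB L n) : Prop := ∀ i, (kb i).ont = ∅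

def IsReducible (kb : DynamicKB L n) (U : Set σ.Pred) : Prop :=
  kb.IsOntReducible U ∨ kb.IsProgReducible

/-- `U` is an update-enabling splitting sequence for `kb`. -/
structure IsUpdateEnabling (kb : DynamicKB L n) (U : PredSeq.{u, v, o} σ) : Prop where
  splitting : kb.IsSplittingSequence U
  zero : 0 < U.length → (kb.bottom (U.set 0)).IsReducible ∅
  succ : ∀ α, Order.succ α < U.length →
    ((kb.bottom (U.set (Order.succ α))).top (U.set α)).IsReducible (U.set α)

/-- `⟨X_α⟩_{α < μ}` is a solution to `kb` with respect to `U = ⟨U_α⟩_{α < μ}`. -/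
structure IsSolution (kb : DynamicKB L n) (U : PredSeq.{u, v, o} σ)
    (X : Ordinal.{o} → Set (Interp σ)) : Prop where
  nonempty : ∀ α < U.length, (X α).Nonempty
  zero : 0 < U.length → (kb.bottom (U.set 0)).IsBasicModel (X 0)
  succ : ∀ α, Order.succ α < U.length →
    ((kb.bottom (U.set (Order.succ α))).reduct (U.set α) (⋂ η ≤ α, X η)).IsBasicModel
      (X (Order.succ α))
  limit : ∀ α < U.length, Order.IsSuccLimit α → X α = Set.univ

/-- `M` is a dynamic MKNF model of `kb` with respect to `U`. -/
def IsDynamicModelWrt (kb : DynamicKB L n) (U : PredSeq.{u, v, o} σ)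
    (M : Set (Interp σ)) : Prop :=
  M.Nonempty ∧ ∃ X, kb.IsSolution U X ∧ M = ⋂ α < U.length, X α

/-- `M` is a dynamic MKNF model of the updatable dynamic hybrid knowledge base `kb`:
a dynamic MKNF model with respect to some update-enabling splitting sequence. -/
def IsDynamicModel (kb : DynamicKB L n) (M : Set (Interp σ)) : Prop :=
  ∃ U : PredSeq.{u, v, o} σ, kb.IsUpdateEnabling U ∧ kb.IsDynamicModelWrt U M

end DynamicKB

end HybridMKNF

/-! A splitting sequence matters only through the rank that it gives to each predicate symbol, the
first index at which the symbol enters. The level sets of the rank are the layers. All symbols of an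
axiom have the same rank, and body symbols of a rule have at most the rank of the head.

In a model, `X α` constrains only atoms of the layer of rank `α`, so the `X α` are independent
factors of their intersection `M` and can be recovered from it as projections. A literal of a lower
layer has the same truth value in `M` as in the partial intersection used by the reduct. Hence the
recursion over `α` disappears: `M` is a model iff it is the product of its projections to the
layers, and each projection is a basic model of its layer with foreign body literals evaluated in
`M` itself (`isDynamicModelWrt_iff_isStratifiedModel`).

For two sequences with ranks `ρ` and `τ`, both conditions turn out to be equivalent to the same
condition on the common refinement, whose cells are the intersections of a `ρ`-layer with a
`τ`-layer (`isStratifiedModel_iff_refine`). This rests on one splitting theorem for each kind of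
layer. Minimal change updates commute with products over disjoint sets of symbols
(`updateSeq_iInter`). A dynamic stable model of a program whose rules respect a well-founded order
of layers is a family of dynamic stable models of the layers (`isDynamicStableModel_iff_progCell`).
A layer or cell may be of both kinds, but then both semantics give the interpretations that contain
all facts (`isBasicModel_iff_facts`). -/

namespace HybridMKNF

variable {σ : Signature.{u, v}} {L : DescriptionLogic.{u, v, w} σ} {n : ℕ}

/-! ### Cylinders of interpretations -/

/-- `I` and `J` contain the same ground atoms with predicate symbol in `C`. -/
def AgreeOn (C : Set σ.Pred) (I J : Interp σ) : Prop :=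
  ∀ p : GroundAtom σ, p.pred ∈ C → (p ∈ I ↔ p ∈ J)

/-- The cylinder over the projection of `M` to the predicate symbols in `C`. -/
def cyl (C : Set σ.Pred) (M : Set (Interp σ)) : Set (Interp σ) := {J | ∃ I ∈ M, AgreeOn C I J}

/-- Membership in `A` depends only on the ground atoms with predicate symbol in `C`. -/
def IsCyl (C : Set σ.Pred) (A : Set (Interp σ)) : Prop := ∀ I J, AgreeOn C I J → I ∈ A → J ∈ A

/-- The interpretation that is `I` on `C` and `J` elsewhere. -/
def glue (C : Set σ.Pred) (I J : Interp σ) : Interp σ :=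
  {p | (p.pred ∈ C ∧ p ∈ I) ∨ (p.pred ∉ C ∧ p ∈ J)}

theorem mem_glue_of_mem {C : Set σ.Pred} {I J : Interp σ} {p : GroundAtom σ} (h : p.pred ∈ C) :
    p ∈ glue C I J ↔ p ∈ I := by
  simp [glue, h]

theorem mem_glue_of_notMem {C : Set σ.Pred} {I J : Interp σ} {p : GroundAtom σ}
    (h : p.pred ∉ C) : p ∈ glue C I J ↔ p ∈ J := by
  simp [glue, h]

theorem AgreeOn.refl (C : Set σ.Pred) (I : Interp σ) : AgreeOn C I I := fun _ _ => Iff.rfl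

theorem AgreeOn.trans {C : Set σ.Pred} {I J K : Interp σ} (h : AgreeOn C I J)
    (h' : AgreeOn C J K) : AgreeOn C I K := fun p hp => (h p hp).trans (h' p hp)

theorem AgreeOn.mono {C D : Set σ.Pred} {I J : Interp σ} (hCD : C ⊆ D) (h : AgreeOn D I J) :
    AgreeOn C I J := fun p hp => h p (hCD hp)

theorem subset_cyl (C : Set σ.Pred) (M : Set (Interp σ)) : M ⊆ cyl C M :=
  fun I hI => ⟨I, hI, .refl _ _⟩

theorem isCyl_cyl (C : Set σ.Pred) (M : Set (Interp σ)) : IsCyl C (cyl C M) :=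
  fun _ _ h ⟨K, hK, hKI⟩ => ⟨K, hK, hKI.trans h⟩

theorem cyl_anti {C D : Set σ.Pred} (hCD : C ⊆ D) (M : Set (Interp σ)) : cyl D M ⊆ cyl C M :=
  fun _ ⟨I, hI, h⟩ => ⟨I, hI, h.mono hCD⟩

theorem cyl_empty {M : Set (Interp σ)} (hM : M.Nonempty) : cyl ∅ M = Set.univ :=
  Set.eq_univ_of_forall fun _ => ⟨hM.some, hM.some_mem, fun _ h => h.elim⟩

theorem cyl_cyl {C D : Set σ.Pred} (hCD : C ⊆ D) (M : Set (Interp σ)) :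
    cyl C (cyl D M) = cyl C M := by
  ext J
  constructor
  · rintro ⟨I, ⟨K, hK, hKI⟩, hIJ⟩
    exact ⟨K, hK, (hKI.mono hCD).trans hIJ⟩
  · rintro ⟨I, hI, hIJ⟩
    exact ⟨I, subset_cyl _ _ hI, hIJ⟩

/-- The projection of a nonempty product of cylinders to one of the factors. -/
theorem cyl_iInter {ι : Sort*} {C : ι → Set σ.Pred}
    (hC : ∀ P i j, P ∈ C i → P ∈ C j → i = j) {A : ι → Set (Interp σ)}
    (hA : ∀ i, IsCyl (C i) (A i)) (hne : (⋂ i, A i).Nonempty) (i : ι) :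
    cyl (C i) (⋂ i, A i) = A i := by
  obtain ⟨K, hK⟩ := hne
  rw [Set.mem_iInter] at hK
  ext J
  constructor
  · rintro ⟨I, hI, hIJ⟩
    exact hA i I J hIJ (Set.mem_iInter.1 hI i)
  · intro hJ
    -- The point `K` of the product fills in the other factors; this is where nonemptiness enters.
    refine ⟨glue (C i) J K, Set.mem_iInter.2 fun j => ?_, fun p hp => mem_glue_of_mem hp⟩
    by_cases hij : i = j
    · subst hij
      exact hA i J _ (fun p hp => (mem_glue_of_mem hp).symm) hJ
    · exact hA j K _ (fun p hp => (mem_glue_of_notMem fun h => hij (hC _ _ _ h hp)).symm) (hK j)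

/-- A set between `M` and its cylinder over `C` knows the same ground atoms over `C` as `M`. -/
theorem forall_mem_iff_of_subset_cyl {C : Set σ.Pred} {M X : Set (Interp σ)} (hMX : M ⊆ X)
    (hX : X ⊆ cyl C M) {p : GroundAtom σ} (hp : p.pred ∈ C) :
    (∀ J ∈ X, p ∈ J) ↔ ∀ J ∈ M, p ∈ J := by
  refine ⟨fun h J hJ => h J (hMX hJ), fun h J hJ => ?_⟩
  obtain ⟨I, hI, hIJ⟩ := hX hJ
  exact (hIJ p hp).1 (h I hI)

/-! ### Satisfaction of first-order sentences -/

/-- Because there are no truth constants, every axiom mentions some symbol. It therefore belongs to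
a definite layer, and an empty layer contains no axioms. -/
theorem Formula.preds_nonempty {n : ℕ} (φ : Formula σ n) : φ.preds.Nonempty := by
  induction φ with
  | atom P t => exact ⟨P, rfl⟩
  | neg φ ih => exact ih
  | conj φ ψ ih₁ ih₂ => exact ih₁.mono Set.subset_union_left
  | ex φ ih => exact ih
  | know φ ih => exact ih
  | naf φ ih => exact ih

theorem Formula.IsFirstOrder.sat_congr {n : ℕ} {φ : Formula σ n} (h : φ.IsFirstOrder)
    {C : Set σ.Pred} (hC : φ.preds ⊆ C) {I J : Interp σ} (hIJ : AgreeOn C I J)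
    (e : Fin n → σ.Const) (M N : Set (Interp σ)) : φ.Sat e I M N ↔ φ.Sat e J M N := by
  induction φ with
  | atom P t => exact hIJ _ (hC rfl)
  | neg φ ih => exact not_congr (ih h hC e)
  | conj φ ψ ih₁ ih₂ =>
    exact and_congr (ih₁ h.1 (Set.subset_union_left.trans hC) e)
      (ih₂ h.2 (Set.subset_union_right.trans hC) e)
  | ex φ ih => exact exists_congr fun c => ih h hC (Fin.snoc e c)
  | know φ ih => exact h.elim
  | naf φ ih => exact h.elim

theorem mem_mod_iff {T : Set (Sentence σ)} (hT : ∀ φ ∈ T, φ.IsFirstOrder) {I : Interp σ} :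
    I ∈ mod T ↔ ∀ φ ∈ T, φ.Sat Fin.elim0 I ∅ ∅ := by
  constructor
  · intro hI φ hφ
    exact ((hT φ hφ).sat_iff _ I _ _ _ _).1 ((isGreatest_mod hT).1 φ hφ I hI)
  · intro h
    have hI : Models {I} T := by
      rintro φ hφ J rfl
      exact ((hT φ hφ).sat_iff _ J _ _ _ _).1 (h φ hφ)
    exact (isGreatest_mod hT).2 hI rfl

theorem isCyl_mod {T : Set (Sentence σ)} (hT : ∀ φ ∈ T, φ.IsFirstOrder) {C : Set σ.Pred}
    (hC : ∀ φ ∈ T, φ.preds ⊆ C) : IsCyl C (mod T) := by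
  intro I J hIJ hI
  rw [mem_mod_iff hT] at hI ⊢
  exact fun φ hφ => ((hT φ hφ).sat_congr (hC φ hφ) hIJ _ _ _).1 (hI φ hφ)

/-! ### Minimal change updates of products -/

/-- Splitting the difference by predicate symbol loses nothing: the order is inclusion of the full
symmetric differences. -/
theorem closerEq_iff {I J J' : Interp σ} :
    CloserEq I J J' ↔ ∀ p, ¬(p ∈ I ↔ p ∈ J) → ¬(p ∈ I ↔ p ∈ J') := by
  constructor
  · intro h p hp
    have := @h p.pred p
    simp only [diff, restrPred, Set.mem_union, Set.mem_sdiff, Set.mem_ofPred_eq] at this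
    tauto
  · intro h P p
    have := h p
    simp only [diff, restrPred, Set.mem_union, Set.mem_sdiff, Set.mem_ofPred_eq]
    tauto

theorem mem_update_iff {M N : Set (Interp σ)} {J : Interp σ} :
    J ∈ update M N ↔ J ∈ N ∧ ∃ I ∈ M, ∀ J' ∈ N, CloserEq I J' J → CloserEq I J J' := by
  simp only [update, updateOne, Closer, Set.mem_iUnion, Set.mem_ofPred_eq]
  constructor
  · rintro ⟨I, hI, hJ, h⟩
    exact ⟨hJ, I, hI, fun J' hJ' h' => by_contra fun h'' => h ⟨J', hJ', h', h''⟩⟩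
  · rintro ⟨hJ, I, hI, h⟩
    exact ⟨I, hI, hJ, fun ⟨J', hJ', h', h''⟩ => h'' (h J' hJ' h')⟩

/-- Closeness is compared atom by atom, so minimality can be tested on each block of symbols
separately. The blocks need not cover all symbols; on the uncovered ones a witness can be chosen
equal to the result. -/
theorem update_iInter {ι : Sort*} {C : ι → Set σ.Pred}
    (hC : ∀ P i j, P ∈ C i → P ∈ C j → i = j) {M N : ι → Set (Interp σ)}
    (hM : ∀ i, IsCyl (C i) (M i)) (hN : ∀ i, IsCyl (C i) (N i)) :
    update (⋂ i, M i) (⋂ i, N i) = ⋂ i, update (M i) (N i) := by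
  ext J
  simp only [Set.mem_iInter, mem_update_iff]
  constructor
  · rintro ⟨hJ, I, hI, hmin⟩ i
    -- With `J` as the starting point outside the block, `J` has no difference there. A competitor
    -- at least as close must then agree with `J` there, and so lies in every other factor as well.
    refine ⟨hJ i, glue (C i) I J,
      hM i I _ (fun p hp => (mem_glue_of_mem hp).symm) (hI i), fun J' hJ' hle => ?_⟩
    rw [closerEq_iff] at hle
    have hoff : ∀ p : GroundAtom σ, p.pred ∉ C i → (p ∈ J' ↔ p ∈ J) := fun p hp => by
      have := hle p
      rw [mem_glue_of_notMem hp] at this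
      tauto
    have hJ'N : ∀ j, J' ∈ N j := fun j => by
      by_cases hij : i = j
      · exact hij ▸ hJ'
      · exact hN j J J' (fun p hp => (hoff p fun h => hij (hC _ _ _ h hp)).symm) (hJ j)
    have hle' : CloserEq I J' J := closerEq_iff.2 fun p => by
      by_cases hp : p.pred ∈ C i
      · have := hle p
        rwa [mem_glue_of_mem hp] at this
      · rw [hoff p hp]
        exact id
    have := closerEq_iff.1 (hmin J' hJ'N hle')
    refine closerEq_iff.2 fun p => ?_
    by_cases hp : p.pred ∈ C i
    · rw [mem_glue_of_mem hp]
      exact this p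
    · rw [mem_glue_of_notMem hp]
      tauto
  · intro h
    choose hJ I hI hmin using h
    -- The starting points of the blocks are assembled, with `J` on symbols in no block.
    let I' : Interp σ := {p | (∃ i, p.pred ∈ C i ∧ p ∈ I i) ∨ ((∀ i, p.pred ∉ C i) ∧ p ∈ J)}
    have hon : ∀ i (p : GroundAtom σ), p.pred ∈ C i → (p ∈ I' ↔ p ∈ I i) := by
      intro i p hp
      constructor
      · rintro (⟨j, hj, hpj⟩ | ⟨h, -⟩)
        · exact hC _ _ _ hj hp ▸ hpj
        · exact (h i hp).elim
      · exact fun h => Or.inl ⟨i, hp, h⟩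
    have hoff : ∀ p : GroundAtom σ, (∀ i, p.pred ∉ C i) → (p ∈ I' ↔ p ∈ J) := by
      intro p hp
      constructor
      · rintro (⟨j, hj, -⟩ | ⟨-, h⟩)
        · exact (hp j hj).elim
        · exact h
      · exact fun h => Or.inr ⟨hp, h⟩
    refine ⟨hJ, I', fun i => hM i (I i) I' (fun p hp => (hon i p hp).symm) (hI i),
      fun J' hJ' hle => closerEq_iff.2 fun p => ?_⟩
    rw [closerEq_iff] at hle
    by_cases hp : ∃ i, p.pred ∈ C i
    · obtain ⟨i, hp⟩ := hp
      have := closerEq_iff.1 (hmin i (glue (C i) J' J)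
        (hN i J' _ (fun p hp => (mem_glue_of_mem hp).symm) (hJ' i))
        (closerEq_iff.2 fun q => by
          by_cases hq : q.pred ∈ C i
          · rw [mem_glue_of_mem hq, ← hon i q hq]
            exact hle q
          · rw [mem_glue_of_notMem hq]
            exact id)) p
      rwa [mem_glue_of_mem hp, ← hon i p hp] at this
    · rw [hoff p (not_exists.1 hp)]
      tauto

theorem IsCyl.update {C : Set σ.Pred} {M N : Set (Interp σ)} (hM : IsCyl C M)
    (hN : IsCyl C N) : IsCyl C (update M N) := by
  intro J K hJK hJ
  rw [mem_update_iff] at hJ ⊢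
  obtain ⟨hJN, I, hI, hmin⟩ := hJ
  refine ⟨hN J K hJK hJN, glue C I K, hM I _ (fun p hp => (mem_glue_of_mem hp).symm) hI,
    fun K' hK' hle => ?_⟩
  rw [closerEq_iff] at hle
  have := closerEq_iff.1 (hmin (glue C K' J) (hN K' _ (fun p hp => (mem_glue_of_mem hp).symm) hK')
    (closerEq_iff.2 fun p => by
      by_cases hp : p.pred ∈ C
      · have := hle p
        rw [mem_glue_of_mem hp, ← hJK p hp] at this
        rwa [mem_glue_of_mem hp]
      · rw [mem_glue_of_notMem hp]
        exact id))
  refine closerEq_iff.2 fun p => ?_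
  by_cases hp : p.pred ∈ C
  · have := this p
    rw [mem_glue_of_mem hp] at this
    rwa [mem_glue_of_mem hp, ← hJK p hp]
  · rw [mem_glue_of_notMem hp]
    tauto

theorem isCyl_updateSeq {C : Set σ.Pred} {N : Fin n → Set (Interp σ)}
    (hN : ∀ i, IsCyl C (N i)) : IsCyl C (updateSeq n N) := by
  induction n with
  | zero => exact fun _ _ _ _ => trivial
  | succ n ih => exact (ih fun i => hN i.castSucc).update (hN _)

theorem updateSeq_iInter {ι : Sort*} {C : ι → Set σ.Pred}
    (hC : ∀ P i j, P ∈ C i → P ∈ C j → i = j) {N : ι → Fin n → Set (Interp σ)}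
    (hN : ∀ i k, IsCyl (C i) (N i k)) :
    updateSeq n (fun k => ⋂ i, N i k) = ⋂ i, updateSeq n (N i) := by
  induction n with
  | zero => exact (Set.iInter_eq_univ.2 fun _ => rfl).symm
  | succ n ih =>
    simp only [updateSeq]
    rw [ih fun i k => hN i k.castSucc,
      update_iInter hC (fun i => isCyl_updateSeq fun k => hN i k.castSucc) fun i => hN i _]

/-- Updating by facts keeps earlier facts. The cheapest way to reach `G` from `I` is `I ∪ G`, which
loses no atom of `I`; conversely, an interpretation that already satisfies both is its own starting
point. -/
theorem update_upper (F G : Interp σ) :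
    update {J | F ⊆ J} {J | G ⊆ J} = {J | F ∪ G ⊆ J} := by
  ext J
  simp only [mem_update_iff, Set.mem_ofPred_eq]
  constructor
  · rintro ⟨hG, I, hF, hmin⟩
    refine Set.union_subset (fun p hp => ?_) hG
    have := closerEq_iff.1 (hmin (I ∪ G) Set.subset_union_right (closerEq_iff.2 fun q => ?_)) p
    · have hpI := hF hp
      simp only [Set.mem_union] at this
      tauto
    · have := @hG q
      simp only [Set.mem_union]
      tauto
  · intro h
    refine ⟨Set.subset_union_right.trans h, J, Set.subset_union_left.trans h,
      fun J' _ _ => closerEq_iff.2 fun q => ?_⟩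
    tauto

theorem updateSeq_upper (F : Fin n → Interp σ) :
    updateSeq n (fun i => {J | F i ⊆ J}) = {J | ⋃ i, F i ⊆ J} := by
  induction n with
  | zero => simp [updateSeq]
  | succ n ih =>
    simp only [updateSeq]
    rw [ih fun i => F i.castSucc, update_upper]
    congr 1
    ext J
    simp only [Set.union_subset_iff, Set.iUnion_subset_iff, Fin.forall_fin_succ']

/-! ### Splitting dynamic stable models -/

/-- The predicate symbol of a literal. -/
def Literal.pred : Literal σ → σ.Pred
  | .pos p => p.pred
  | .dneg p => p.pred

theorem Literal.preds_eq (K : Literal σ) : K.preds = {K.pred} := by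
  cases K <;> rfl

theorem Literal.preds_subset_iff {K : Literal σ} {C : Set σ.Pred} :
    K.preds ⊆ C ↔ K.pred ∈ C := by
  rw [K.preds_eq, Set.singleton_subset_iff]

theorem Literal.pred_compl (K : Literal σ) : K.compl.pred = K.pred := by
  cases K <;> rfl

theorem least_subset {Q : Set (Rule σ)} {S : Set (Literal σ)}
    (h : ∀ r ∈ Q, (∀ K ∈ r.body, K ∈ S) → r.head ∈ S) : least Q ⊆ S :=
  Set.sInter_subset_of_mem h

theorem head_mem_least {Q : Set (Rule σ)} {r : Rule σ} (hr : r ∈ Q)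
    (h : ∀ K ∈ r.body, K ∈ least Q) : r.head ∈ least Q :=
  Set.mem_sInter.2 fun _ hS => hS r hr fun K hK => Set.mem_sInter.1 (h K hK) _ hS

/-- Default assumptions yield only default literals, so a true atom must come from a rule head. -/
theorem IsDynamicStableModel.exists_head {Q : Fin n → Set (Rule σ)} {I : Interp σ}
    (h : IsDynamicStableModel Q I) {p : GroundAtom σ} (hp : p ∈ I) :
    ∃ i, ∃ r ∈ Q i, r.head = .pos p := by
  by_contra hno
  have hsub : least (unrejected Q I ∪ defaults Q I) ⊆ {K | K ≠ .pos p} := by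
    refine least_subset ?_
    rintro r (⟨i, hr, -⟩ | ⟨q, rfl, -⟩) -
    · exact fun h => hno ⟨i, r, hr, h⟩
    · rintro ⟨⟩
  rw [← show _ = _ from h] at hsub
  exact hsub (show Literal.Holds I (.pos p) from hp) rfl

/-- The rules with head in the `j`-th layer of `τ` whose body literals outside of this layer are
true in `I`, without these body literals. -/
def progCell {κ : Type*} (Q : Fin n → Set (Rule σ)) (τ : σ.Pred → κ) (j : κ) (I : Interp σ) :
    Fin n → Set (Rule σ) :=
  fun i => {r' | ∃ r ∈ Q i, τ r.head.pred = j ∧ (∀ K ∈ r.body, τ K.pred ≠ j → K.Holds I) ∧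
    r'.head = r.head ∧ ∀ K, K ∈ r'.body ↔ K ∈ r.body ∧ τ K.pred = j}

section Split

variable {κ : Type*} {Q : Fin n → Set (Rule σ)} {τ : σ.Pred → κ} {I : Interp σ}

/-- The restriction of an interpretation to a layer. -/
def restrLayer (τ : σ.Pred → κ) (j : κ) (I : Interp σ) : Interp σ := {p ∈ I | τ p.pred = j}

theorem Literal.holds_restrLayer {j : κ} {K : Literal σ} (h : τ K.pred = j) :
    K.Holds (restrLayer τ j I) ↔ K.Holds I := by
  cases K with
  | pos p => exact and_iff_left h
  | dneg p => exact not_congr (and_iff_left h)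

open Classical in
theorem exists_rule_progCell {j : κ} {i : Fin n} {r : Rule σ} (hr : r ∈ Q i)
    (hj : τ r.head.pred = j) (hI : ∀ K ∈ r.body, τ K.pred ≠ j → K.Holds I) :
    ∃ r' ∈ progCell Q τ j I i,
      r'.head = r.head ∧ ∀ K, K ∈ r'.body ↔ K ∈ r.body ∧ τ K.pred = j := by
  refine ⟨⟨r.head, r.body.filter fun K => τ K.pred = j⟩, ⟨r, hr, hj, hI, rfl, ?_⟩, rfl, ?_⟩ <;>
    simp

theorem exists_bodyHolds_progCell {j : κ} {i : Fin n} {H : Literal σ} (hH : τ H.pred = j) :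
    (∃ r ∈ progCell Q τ j I i, r.head = H ∧ r.BodyHolds (restrLayer τ j I)) ↔
      ∃ r ∈ Q i, r.head = H ∧ r.BodyHolds I := by
  constructor
  · rintro ⟨r', ⟨r, hr, hj, hI, hh, hb⟩, rfl, hB⟩
    refine ⟨r, hr, hh.symm, fun K hK => ?_⟩
    by_cases hKj : τ K.pred = j
    · exact (Literal.holds_restrLayer hKj).1 (hB K ((hb K).2 ⟨hK, hKj⟩))
    · exact hI K hK hKj
  · rintro ⟨r, hr, rfl, hB⟩
    obtain ⟨r', hr', hh, hb⟩ := exists_rule_progCell hr hH fun K hK _ => hB K hK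
    exact ⟨r', hr', hh, fun K hK =>
      (Literal.holds_restrLayer ((hb K).1 hK).2).2 (hB K ((hb K).1 hK).1)⟩

/-- Conflicting heads share their atom, so a rejecting rule always lies in the same layer as the
rejected one. -/
theorem rejected_progCell {j : κ} {i : Fin n} {H : Literal σ} (hH : τ H.pred = j) :
    (∃ k, i ≤ k ∧ ∃ r' ∈ progCell Q τ j I k,
        H = r'.head.compl ∧ r'.BodyHolds (restrLayer τ j I)) ↔
      ∃ k, i ≤ k ∧ ∃ r' ∈ Q k, H = r'.head.compl ∧ r'.BodyHolds I := by
  have hc : ∀ K : Literal σ, H = K.compl ↔ K = H.compl := by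
    intro K
    cases K <;> cases H <;> simp [Literal.compl, eq_comm]
  simp only [hc]
  exact exists_congr fun k => and_congr_right fun _ =>
    exists_bodyHolds_progCell (H.pred_compl ▸ hH)

theorem mem_unrejected_progCell {j : κ} {r' : Rule σ} :
    r' ∈ unrejected (progCell Q τ j I) (restrLayer τ j I) ↔
      ∃ r ∈ unrejected Q I, τ r.head.pred = j ∧ (∀ K ∈ r.body, τ K.pred ≠ j → K.Holds I) ∧
        r'.head = r.head ∧ ∀ K, K ∈ r'.body ↔ K ∈ r.body ∧ τ K.pred = j := by
  constructor
  · rintro ⟨i, ⟨r, hr, hj, hI, hh, hb⟩, hrej⟩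
    rw [hh, rejected_progCell hj] at hrej
    exact ⟨r, ⟨i, hr, hrej⟩, hj, hI, hh, hb⟩
  · rintro ⟨r, ⟨i, hr, hrej⟩, hj, hI, hh, hb⟩
    refine ⟨i, ⟨r, hr, hj, hI, hh, hb⟩, ?_⟩
    rwa [hh, rejected_progCell hj]

theorem mem_defaults_progCell {j : κ} {p : GroundAtom σ} (hp : τ p.pred = j) :
    (⟨.dneg p, ∅⟩ : Rule σ) ∈ defaults (progCell Q τ j I) (restrLayer τ j I) ↔
      (⟨.dneg p, ∅⟩ : Rule σ) ∈ defaults Q I := by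
  have key : (∃ i, ∃ r ∈ progCell Q τ j I i,
      r.head = .pos p ∧ r.BodyHolds (restrLayer τ j I)) ↔
      ∃ i, ∃ r ∈ Q i, r.head = .pos p ∧ r.BodyHolds I :=
    exists_congr fun i => exists_bodyHolds_progCell (H := .pos p) hp
  constructor
  · rintro ⟨q, hq, h⟩
    obtain rfl : p = q := by injection hq with h; injection h
    exact ⟨p, rfl, fun h' => h (key.2 h')⟩
  · rintro ⟨q, hq, h⟩
    obtain rfl : p = q := by injection hq with h; injection h
    exact ⟨p, rfl, fun h' => h (key.1 h')⟩

/-- No rule of the cell has a head in another layer. All foreign atoms are thus false by default, as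
they are in the restricted interpretation. -/
theorem mem_defaults_progCell_of_ne {j : κ} {p : GroundAtom σ} (hp : τ p.pred ≠ j) :
    (⟨.dneg p, ∅⟩ : Rule σ) ∈ defaults (progCell Q τ j I) (restrLayer τ j I) := by
  refine ⟨p, rfl, ?_⟩
  rintro ⟨i, r', ⟨r, -, hj, -, hh, -⟩, hp', -⟩
  rw [← hh, hp'] at hj
  exact hp hj

/-- A derivation in the whole program uses only true literals, so its steps inside the layer can be
repeated in the cell, where true foreign body literals have been deleted. No order of the layers is
needed in this direction. -/
theorem IsDynamicStableModel.progCell (h : IsDynamicStableModel Q I) (j : κ) :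
    IsDynamicStableModel (progCell Q τ j I) (restrLayer τ j I) := by
  have hT : ∀ K, K.Holds I ↔ K ∈ least (unrejected Q I ∪ defaults Q I) :=
    fun K => Set.ext_iff.1 h K
  apply Set.Subset.antisymm
  · intro K hK S hS
    -- Truth in `I` is carried along in the closed set so that foreign body literals are known to be
    -- true when a rule fires.
    let S' : Set (Literal σ) := {K | K.Holds I ∧ (τ K.pred = j → K ∈ S)}
    have hS' : least (unrejected Q I ∪ defaults Q I) ⊆ S' := by
      refine least_subset fun r hr hb => ?_
      refine ⟨(hT _).2 (head_mem_least hr fun K hK => (hT K).1 (hb K hK).1), fun hj => ?_⟩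
      rcases hr with hr | ⟨p, rfl, hp⟩
      · classical
        refine hS ⟨r.head, r.body.filter fun K => τ K.pred = j⟩
          (Or.inl (mem_unrejected_progCell.2
            ⟨r, hr, hj, fun K hK _ => (hb K hK).1, rfl, by simp⟩)) ?_
        intro K hK
        rw [Finset.mem_filter] at hK
        exact (hb K hK.1).2 hK.2
      · exact hS ⟨.dneg p, ∅⟩ (Or.inr ((mem_defaults_progCell hj).2 ⟨p, rfl, hp⟩)) (by simp)
    by_cases hj : τ K.pred = j
    · exact (hS' ((hT K).1 ((Literal.holds_restrLayer hj).1 hK))).2 hj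
    · cases K with
      | pos p => exact (hj hK.2).elim
      | dneg p => exact hS ⟨.dneg p, ∅⟩ (Or.inr (mem_defaults_progCell_of_ne hj)) (by simp)
  · refine least_subset ?_
    rintro r' (hr' | ⟨p, rfl, hp⟩) hb'
    · obtain ⟨r, hr, hj, hI, hh, hb⟩ := mem_unrejected_progCell.1 hr'
      rw [hh]
      refine (Literal.holds_restrLayer hj).2
        ((hT _).2 (head_mem_least (Or.inl hr) fun K hK => (hT K).1 ?_))
      by_cases hKj : τ K.pred = j
      · exact (Literal.holds_restrLayer hKj).1 (hb' K ((hb K).2 ⟨hK, hKj⟩))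
      · exact hI K hK hKj
    · by_cases hj : τ p.pred = j
      · refine (Literal.holds_restrLayer (K := .dneg p) hj).2 ((hT _).2 ?_)
        exact head_mem_least (r := ⟨.dneg p, ∅⟩)
          (Or.inr ((mem_defaults_progCell hj).1 ⟨p, rfl, hp⟩)) (by simp)
      · exact fun h => hj h.2

/-- The cells take foreign body literals as given, so the converse must exclude circular support
between layers: these literals lie in strictly lower layers, and well-founded induction derives them
first. -/
theorem isDynamicStableModel_iff_progCell [LinearOrder κ] [WellFoundedLT κ]
    (hQ : ∀ i, ∀ r ∈ Q i, ∀ K ∈ r.body, τ K.pred ≤ τ r.head.pred) :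
    IsDynamicStableModel Q I ↔
      ∀ j, IsDynamicStableModel (progCell Q τ j I) (restrLayer τ j I) := by
  refine ⟨fun h j => h.progCell j, fun h => ?_⟩
  have hT : ∀ j K, K.Holds (restrLayer τ j I) ↔ K ∈ least
      (unrejected (progCell Q τ j I) (restrLayer τ j I) ∪
        defaults (progCell Q τ j I) (restrLayer τ j I)) :=
    fun j K => Set.ext_iff.1 (h j) K
  apply Set.Subset.antisymm
  · intro K hK S hS
    suffices hsuff : ∀ j, ∀ K : Literal σ, τ K.pred = j → K.Holds I → K ∈ S from
      hsuff _ K rfl hK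
    intro j
    induction j using WellFoundedLT.induction with
    | ind j ih =>
      intro K hj hK
      have hsub : least (unrejected (progCell Q τ j I) (restrLayer τ j I) ∪
          defaults (progCell Q τ j I) (restrLayer τ j I)) ⊆
          {K | τ K.pred = j → K ∈ S} := by
        refine least_subset ?_
        rintro r' (hr' | ⟨p, rfl, hp⟩) hb' hj'
        · obtain ⟨r, hr, hj, hI, hh, hb⟩ := mem_unrejected_progCell.1 hr'
          rw [hh]
          refine hS r (Or.inl hr) fun K hK => ?_
          by_cases hKj : τ K.pred = j
          · exact hb' K ((hb K).2 ⟨hK, hKj⟩) hKj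
          · obtain ⟨i, hri, -⟩ := hr
            exact ih _ (lt_of_le_of_ne (hj ▸ hQ i r hri K hK) hKj) K rfl (hI K hK hKj)
        · exact hS ⟨.dneg p, ∅⟩ (Or.inr ((mem_defaults_progCell hj').1 ⟨p, rfl, hp⟩)) (by simp)
      exact hsub ((hT j K).1 ((Literal.holds_restrLayer hj).2 hK)) hj
  · refine least_subset ?_
    rintro r (hr | ⟨p, rfl, hp⟩) hb
    · classical
      refine (Literal.holds_restrLayer (τ := τ) rfl).1 ((hT (τ r.head.pred) r.head).2 ?_)
      refine head_mem_least (r := ⟨r.head, r.body.filter fun K => τ K.pred = τ r.head.pred⟩)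
        (Or.inl (mem_unrejected_progCell.2
          ⟨r, hr, rfl, fun K hK _ => hb K hK, rfl, by simp⟩)) ?_
      intro K hK
      rw [Finset.mem_filter] at hK
      exact (hT _ K).1 ((Literal.holds_restrLayer hK.2).2 (hb K hK.1))
    · refine (Literal.holds_restrLayer (τ := τ) (K := .dneg p) rfl).1 ((hT (τ p.pred) _).2 ?_)
      exact head_mem_least (r := ⟨.dneg p, ∅⟩)
        (Or.inr ((mem_defaults_progCell rfl).2 ⟨p, rfl, hp⟩)) (by simp)

end Split

/-! ### Basic dynamic knowledge bases that are both ontology-based and program-based -/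

namespace DynamicKB

/-- The ground atoms that are facts of the `i`-th program. -/
def facts (kb : DynamicKB L n) (i : Fin n) : Interp σ :=
  {p | (⟨.pos p, ∅⟩ : Rule σ) ∈ (kb i).prog}

theorem theory_isFirstOrder (kb : DynamicKB L n) (i : Fin n) :
    ∀ φ ∈ kb.theory i, φ.IsFirstOrder := by
  rintro φ (⟨a, -, rfl⟩ | ⟨p, -, rfl⟩)
  · exact (L.fo a).2
  · trivial

theorem isMinimalChangeModel_iff_facts {kb : DynamicKB L n} (hP : kb.IsProgBased)
    {M : Set (Interp σ)} (hM : M.Nonempty) :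
    IsMinimalChangeModel kb.theory M ↔ M = {J | ⋃ i, kb.facts i ⊆ J} := by
  have hmod : ∀ i, mod (kb.theory i) = {J | kb.facts i ⊆ J} := by
    intro i
    ext J
    rw [mem_mod_iff (kb.theory_isFirstOrder i)]
    constructor
    · exact fun h p hp => h _ (Or.inr ⟨p, hp, rfl⟩)
    · rintro h φ (⟨a, ha, -⟩ | ⟨p, hp, rfl⟩)
      · rw [hP i] at ha
        exact ha.elim
      · exact h hp
  simp only [IsMinimalChangeModel, hmod, updateSeq_upper, hM, true_and]

theorem isDynamicStableModel_iff_facts {kb : DynamicKB L n} (hO : kb.IsOntBased)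
    {I : Interp σ} :
    IsDynamicStableModel (fun i => (kb i).prog) I ↔ I = ⋃ i, kb.facts i := by
  have hfact : ∀ i, ∀ r ∈ (kb i).prog, ∃ p ∈ kb.facts i, r = ⟨.pos p, ∅⟩ := by
    intro i r hr
    obtain ⟨⟨p, hp⟩, hb⟩ := hO i r hr
    obtain ⟨H, B⟩ := r
    cases hp
    cases hb
    exact ⟨p, hr, rfl⟩
  have hleast : least (unrejected (fun i => (kb i).prog) I ∪ defaults (fun i => (kb i).prog) I) =
      {K | K.Holds (⋃ i, kb.facts i)} := by
    apply Set.Subset.antisymm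
    · refine least_subset ?_
      rintro r (⟨i, hr, -⟩ | ⟨p, rfl, hp⟩) -
      · obtain ⟨p, hp, rfl⟩ := hfact i r hr
        exact Set.mem_iUnion.2 ⟨i, hp⟩
      · intro h
        obtain ⟨i, hi⟩ := Set.mem_iUnion.1 h
        exact hp ⟨i, _, hi, rfl, fun K hK => by simp at hK⟩
    · rintro (p | p) hp
      · obtain ⟨i, hi⟩ := Set.mem_iUnion.1 hp
        refine head_mem_least (r := ⟨.pos p, ∅⟩) (Or.inl ⟨i, hi, ?_⟩) (by simp)
        rintro ⟨j, -, r', hr', hh, -⟩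
        obtain ⟨q, -, rfl⟩ := hfact j r' hr'
        cases hh
      · refine head_mem_least (r := ⟨.dneg p, ∅⟩) (Or.inr ⟨p, rfl, ?_⟩) (by simp)
        rintro ⟨i, r', hr', hh, -⟩
        obtain ⟨q, hq, rfl⟩ := hfact i r' hr'
        injection hh with hh
        exact hp (Set.mem_iUnion.2 ⟨i, hh ▸ hq⟩)
  rw [IsDynamicStableModel, hleast]
  refine ⟨fun h => Set.ext fun p => Set.ext_iff.1 h (.pos p), fun h => by rw [← h]⟩

/-- Both semantics reduce to accumulating facts here, so the disjunction in `IsBasicModel` is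
unambiguous. Elsewhere the applicable kind may be chosen freely. -/
theorem isBasicModel_iff_facts {kb : DynamicKB L n} (hO : kb.IsOntBased) (hP : kb.IsProgBased)
    {M : Set (Interp σ)} (hM : M.Nonempty) :
    kb.IsBasicModel M ↔ M = {J | ⋃ i, kb.facts i ⊆ J} := by
  simp [IsBasicModel, hO, hP, hM, isMinimalChangeModel_iff_facts, isDynamicStableModel_iff_facts]

theorem isBasicModel_iff_of_isOntBased {kb : DynamicKB L n} (hO : kb.IsOntBased)
    {M : Set (Interp σ)} (hM : M.Nonempty) :
    kb.IsBasicModel M ↔ M = updateSeq n fun i => mod (kb.theory i) := by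
  by_cases hP : kb.IsProgBased
  · rw [isBasicModel_iff_facts hO hP hM, ← isMinimalChangeModel_iff_facts hP hM]
    exact and_iff_right hM
  · simp [IsBasicModel, IsMinimalChangeModel, hO, hP, hM]

theorem isBasicModel_iff_of_isProgBased {kb : DynamicKB L n} (hP : kb.IsProgBased)
    {M : Set (Interp σ)} (hM : M.Nonempty) :
    kb.IsBasicModel M ↔
      ∃ I, IsDynamicStableModel (fun i => (kb i).prog) I ∧ M = {J | I ⊆ J} := by
  by_cases hO : kb.IsOntBased
  · rw [isBasicModel_iff_facts hO hP hM]
    simp [isDynamicStableModel_iff_facts hO]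
  · simp [IsBasicModel, hO, hP, hM]

theorem IsBasicModel.isCyl {kb : DynamicKB L n} {M : Set (Interp σ)} (h : kb.IsBasicModel M)
    {C : Set σ.Pred} (hont : ∀ i, ∀ a ∈ (kb i).ont, L.preds a ⊆ C)
    (hprog : ∀ i, ∀ r ∈ (kb i).prog, r.head.pred ∈ C) : IsCyl C M := by
  obtain ⟨-, ⟨-, -, rfl⟩ | ⟨-, I, hI, rfl⟩⟩ := h
  · refine isCyl_updateSeq fun i => isCyl_mod (kb.theory_isFirstOrder i) ?_
    rintro φ (⟨a, ha, rfl⟩ | ⟨p, hp, rfl⟩)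
    · exact hont i a ha
    · exact Set.singleton_subset_iff.2 (hprog i _ hp)
  · intro J K hJK hJ p hp
    obtain ⟨i, r, hr, hh⟩ := hI.exists_head hp
    have := hprog i r hr
    rw [hh] at this
    exact (hJK p this).1 (hJ hp)

end DynamicKB

/-! ### Layers of a dynamic knowledge base -/

/-- Truth of the MKNF translation of a literal in a nonempty set of interpretations. -/
def Literal.HoldsIn (M : Set (Interp σ)) : Literal σ → Prop
  | .pos p => ∀ J ∈ M, p ∈ J
  | .dneg p => ¬ ∀ J ∈ M, p ∈ J

theorem models_toMKNF_iff {X : Set (Interp σ)} (hX : X.Nonempty) {S : Set (Literal σ)} :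
    Models X (Literal.toMKNF '' S) ↔ ∀ K ∈ S, K.HoldsIn X := by
  simp only [Models, Set.forall_mem_image]
  refine forall₂_congr fun K _ => ?_
  cases K with
  | pos p => exact ⟨fun h => h _ hX.some_mem, fun h _ _ => h⟩
  | dneg p =>
    simp only [Literal.HoldsIn, not_forall, exists_prop]
    exact ⟨fun h => h _ hX.some_mem, fun h _ _ => h⟩

theorem Literal.holdsIn_congr {M X : Set (Interp σ)} {K : Literal σ}
    (h : ∀ p : GroundAtom σ, p.pred = K.pred → ((∀ J ∈ X, p ∈ J) ↔ ∀ J ∈ M, p ∈ J)) :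
    K.HoldsIn X ↔ K.HoldsIn M := by
  cases K with
  | pos p => exact h p rfl
  | dneg p => exact not_congr (h p rfl)

theorem Literal.holdsIn_iff_holds {M : Set (Interp σ)} {I : Interp σ} {K : Literal σ}
    (h : ∀ p : GroundAtom σ, p.pred = K.pred → ((∀ J ∈ M, p ∈ J) ↔ p ∈ I)) :
    K.HoldsIn M ↔ K.Holds I := by
  cases K with
  | pos p => exact h p rfl
  | dneg p => exact not_congr (h p rfl)

namespace DynamicKB

/-- The part of `kb` about the predicate symbols in `C`, where the body literals about other
predicate symbols are evaluated in `M`. -/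
def layer (C : Set σ.Pred) (M : Set (Interp σ)) (kb : DynamicKB L n) : DynamicKB L n := fun i =>
  { ont := {a ∈ (kb i).ont | L.preds a ⊆ C}
    prog := {r' | ∃ r ∈ (kb i).prog, r.head.pred ∈ C ∧
      (∀ K ∈ r.body, K.pred ∉ C → K.HoldsIn M) ∧
      r'.head = r.head ∧ ∀ K, K ∈ r'.body ↔ K ∈ r.body ∧ K.pred ∈ C} }

/-- The projection of `M` to `C` is a dynamic MKNF model of the part of `kb` about `C`. -/
def IsLocalModel (kb : DynamicKB L n) (C : Set σ.Pred) (M : Set (Interp σ)) : Prop :=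
  (kb.layer C M).IsBasicModel (cyl C M)

variable {kb : DynamicKB L n} {C D : Set σ.Pred} {M : Set (Interp σ)}

theorem head_mem_of_mem_layer {i : Fin n} {r : Rule σ} (hr : r ∈ (kb.layer C M i).prog) :
    r.head.pred ∈ C := by
  obtain ⟨r, -, h, -, hh, -⟩ := hr
  rwa [hh]

/-- Empty layers impose no condition. This disposes of limit indices and of indices beyond the
length of the sequence. -/
theorem isLocalModel_empty (hM : M.Nonempty) : kb.IsLocalModel ∅ M := by
  have hO : (kb.layer ∅ M).IsOntBased := fun i r hr => (head_mem_of_mem_layer hr).elim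
  have hP : (kb.layer ∅ M).IsProgBased := fun i => Set.eq_empty_of_forall_notMem fun a ha =>
    (Formula.preds_nonempty (L.fo a).1).ne_empty (Set.subset_empty_iff.1 ha.2)
  rw [IsLocalModel, isBasicModel_iff_facts hO hP (hM.mono (subset_cyl _ _)), cyl_empty hM]
  refine (Set.eq_univ_of_forall fun J => Set.iUnion_subset fun i p hp => ?_).symm
  exact (head_mem_of_mem_layer (i := i) hp).elim

/-! ### Refining a layer -/

section Refine

variable {κ : Type*} {τ : σ.Pred → κ}

theorem cell_disjoint (D : Set σ.Pred) (τ : σ.Pred → κ) (P : σ.Pred) (i j : κ)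
    (hi : P ∈ D ∩ τ ⁻¹' {i}) (hj : P ∈ D ∩ τ ⁻¹' {j}) : i = j :=
  hi.2.symm.trans hj.2

/-- Each axiom lies in a single cell because `τ` is constant on its symbols. Bodies of rules with
head in `D` lie outside `D`, so they are evaluated in `M` before and after the refinement. -/
theorem mod_theory_layer
    (hax : ∀ i, ∀ a ∈ (kb i).ont, ∀ P ∈ L.preds a, ∀ Q ∈ L.preds a, τ P = τ Q)
    (hD : ∀ i, ∀ r ∈ (kb i).prog, r.head.pred ∈ D → ∀ K ∈ r.body, K.pred ∉ D) (i : Fin n) :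
    mod ((kb.layer D M).theory i) = ⋂ j, mod ((kb.layer (D ∩ τ ⁻¹' {j}) M).theory i) := by
  have key : ∀ φ, φ ∈ (kb.layer D M).theory i ↔
      ∃ j, φ ∈ (kb.layer (D ∩ τ ⁻¹' {j}) M).theory i := by
    intro φ
    constructor
    · rintro (⟨a, ⟨ha, haD⟩, rfl⟩ | ⟨p, ⟨r, hr, hrD, hM, hh, hb⟩, rfl⟩)
      · obtain ⟨P, hP⟩ := Formula.preds_nonempty (L.fo a).1
        exact ⟨τ P, Or.inl ⟨a, ⟨ha, fun Q hQ => ⟨haD hQ, hax i a ha Q hQ P hP⟩⟩, rfl⟩⟩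
      · refine ⟨τ r.head.pred, Or.inr ⟨p, ⟨r, hr, ⟨hrD, rfl⟩,
          fun K hK _ => hM K hK (hD i r hr hrD K hK), hh, fun K => ?_⟩, rfl⟩⟩
        refine ⟨fun h => by simp at h, fun h => (hD i r hr hrD K h.1 h.2.1).elim⟩
    · rintro ⟨j, ⟨a, ⟨ha, haD⟩, rfl⟩ | ⟨p, ⟨r, hr, hrD, hM, hh, hb⟩, rfl⟩⟩
      · exact Or.inl ⟨a, ⟨ha, haD.trans Set.inter_subset_left⟩, rfl⟩
      · refine Or.inr ⟨p, ⟨r, hr, hrD.1, fun K hK hKD => hM K hK fun h => hKD h.1, hh,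
          fun K => ?_⟩, rfl⟩
        refine ⟨fun h => by simp at h, fun h => (hD i r hr hrD.1 K h.1 h.2).elim⟩
  ext J
  simp only [Set.mem_iInter, mem_mod_iff (theory_isFirstOrder _ i), key]
  exact ⟨fun h j φ hφ => h φ ⟨j, hφ⟩, fun h φ ⟨j, hφ⟩ => h j φ hφ⟩

theorem isCyl_mod_theory_layer (i : Fin n) : IsCyl C (mod ((kb.layer C M).theory i)) := by
  refine isCyl_mod (theory_isFirstOrder _ i) ?_
  rintro φ (⟨a, ha, rfl⟩ | ⟨p, hp, rfl⟩)
  · exact ha.2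
  · exact Set.singleton_subset_iff.2 (head_mem_of_mem_layer (i := i) hp)

theorem isOntBased_layer
    (hD : ∀ i, ∀ r ∈ (kb i).prog, r.head.pred ∈ D → r.IsPositive ∧ ∀ K ∈ r.body, K.pred ∉ D)
    (hCD : C ⊆ D) : (kb.layer C M).IsOntBased := by
  rintro i r' ⟨r, hr, hrC, -, hh, hb⟩
  obtain ⟨⟨p, hp⟩, hB⟩ := hD i r hr (hCD hrC)
  refine ⟨⟨p, hh.trans hp⟩, Finset.eq_empty_of_forall_notMem fun K hK => ?_⟩
  exact hB K ((hb K).1 hK).1 (hCD ((hb K).1 hK).2)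

theorem isLocalModel_iff_refine_of_ont
    (hax : ∀ i, ∀ a ∈ (kb i).ont, ∀ P ∈ L.preds a, ∀ Q ∈ L.preds a, τ P = τ Q)
    (hD : ∀ i, ∀ r ∈ (kb i).prog, r.head.pred ∈ D → r.IsPositive ∧ ∀ K ∈ r.body, K.pred ∉ D)
    (hM : M.Nonempty) :
    kb.IsLocalModel D M ↔ cyl D M = ⋂ j, cyl (D ∩ τ ⁻¹' {j}) M ∧
      ∀ j, kb.IsLocalModel (D ∩ τ ⁻¹' {j}) M := by
  have hne : ∀ C, (cyl C M).Nonempty := fun C => hM.mono (subset_cyl _ _)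
  have hprod : updateSeq n (fun i => mod ((kb.layer D M).theory i)) =
      ⋂ j, updateSeq n fun i => mod ((kb.layer (D ∩ τ ⁻¹' {j}) M).theory i) := by
    rw [← updateSeq_iInter (cell_disjoint D τ) fun j i => isCyl_mod_theory_layer i]
    congr 1
    ext1 i
    exact mod_theory_layer hax (fun i r hr h => (hD i r hr h).2) i
  simp only [IsLocalModel, isBasicModel_iff_of_isOntBased (isOntBased_layer hD subset_rfl) (hne _),
    isBasicModel_iff_of_isOntBased (isOntBased_layer hD Set.inter_subset_left) (hne _), hprod]
  constructor
  · intro h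
    have hj : ∀ j, cyl (D ∩ τ ⁻¹' {j}) M =
        updateSeq n fun i => mod ((kb.layer (D ∩ τ ⁻¹' {j}) M).theory i) := by
      intro j
      rw [← cyl_cyl (D := D) Set.inter_subset_left, h]
      exact cyl_iInter (cell_disjoint D τ)
        (fun j => isCyl_updateSeq fun i => isCyl_mod_theory_layer i) (h ▸ hne D) j
    refine ⟨h.trans (Set.iInter_congr fun j => (hj j).symm), hj⟩
  · rintro ⟨h, hj⟩
    exact h.trans (Set.iInter_congr hj)

open Classical in
-- Evaluating in two stages, outside `D` in `M` and then outside the cell in `I`, equals evaluating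
-- at once in `M`, since `I` consists on `D` of exactly the atoms that `M` knows.
theorem prog_layer_cell {I : Interp σ}
    (hI : ∀ p : GroundAtom σ, p.pred ∈ D → ((∀ J ∈ M, p ∈ J) ↔ p ∈ I)) (j : κ) :
    (fun i => (kb.layer (D ∩ τ ⁻¹' {j}) M i).prog) =
      progCell (fun i => (kb.layer D M i).prog) τ j I := by
  have hK : ∀ K : Literal σ, K.pred ∈ D → (K.HoldsIn M ↔ K.Holds I) := fun K hK =>
    Literal.holdsIn_iff_holds fun p hp => hI p (hp ▸ hK)
  funext i
  ext r'
  constructor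
  · rintro ⟨r, hr, hrD, hM, hh, hb⟩
    refine ⟨⟨r.head, r.body.filter fun K => K.pred ∈ D⟩,
      ⟨r, hr, hrD.1, fun K hK hKD => hM K hK fun h => hKD h.1, rfl, by simp⟩, hrD.2, ?_, hh, ?_⟩
    · intro K hKb hKj
      rw [Finset.mem_filter] at hKb
      exact (hK K hKb.2).1 (hM K hKb.1 fun h => hKj h.2)
    · intro K
      rw [hb, Finset.mem_filter, and_assoc]
      rfl
  · rintro ⟨r, ⟨s, hs, hsD, hsM, hsh, hsb⟩, hrj, hrI, hh, hb⟩
    refine ⟨s, hs, ⟨hsD, hsh ▸ hrj⟩, ?_, hh.trans hsh, ?_⟩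
    · intro K hKb hKC
      by_cases hKD : K.pred ∈ D
      · exact (hK K hKD).2 (hrI K ((hsb K).2 ⟨hKb, hKD⟩) fun h => hKC ⟨hKD, h⟩)
      · exact hsM K hKb hKD
    · intro K
      rw [hb, hsb, and_assoc]
      rfl

theorem forall_mem_iff_of_cyl_eq_upper {I : Interp σ} (h : cyl D M = {J | I ⊆ J})
    {p : GroundAtom σ} (hp : p.pred ∈ D) : (∀ J ∈ M, p ∈ J) ↔ p ∈ I := by
  rw [← forall_mem_iff_of_subset_cyl (subset_cyl D M) subset_rfl hp, h]
  exact ⟨fun h => h I fun _ hq => hq, fun h J hJ => hJ h⟩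

theorem pred_mem_of_isDynamicStableModel_layer {I : Interp σ}
    (h : IsDynamicStableModel (fun i => (kb.layer C M i).prog) I) {p : GroundAtom σ}
    (hp : p ∈ I) : p.pred ∈ C := by
  obtain ⟨i, r, hr, hh⟩ := h.exists_head hp
  have := head_mem_of_mem_layer hr
  rwa [hh] at this

theorem isLocalModel_iff_refine_of_prog [LinearOrder κ] [WellFoundedLT κ]
    (hτ : ∀ i, ∀ r ∈ (kb i).prog, ∀ K ∈ r.body, τ K.pred ≤ τ r.head.pred)
    (hD : ∀ i, ∀ a ∈ (kb i).ont, ¬ L.preds a ⊆ D) (hM : M.Nonempty) :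
    kb.IsLocalModel D M ↔ cyl D M = ⋂ j, cyl (D ∩ τ ⁻¹' {j}) M ∧
      ∀ j, kb.IsLocalModel (D ∩ τ ⁻¹' {j}) M := by
  have hne : ∀ C, (cyl C M).Nonempty := fun C => hM.mono (subset_cyl _ _)
  have hP : ∀ C ⊆ D, (kb.layer C M).IsProgBased := fun C hC i =>
    Set.eq_empty_of_forall_notMem fun a ha => hD i a ha.1 (ha.2.trans hC)
  have hQ : ∀ i, ∀ r ∈ (kb.layer D M i).prog, ∀ K ∈ r.body, τ K.pred ≤ τ r.head.pred := by
    rintro i r' ⟨r, hr, -, -, hh, hb⟩ K hK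
    rw [hh]
    exact hτ i r hr K ((hb K).1 hK).1
  simp only [IsLocalModel, isBasicModel_iff_of_isProgBased (hP D subset_rfl) (hne _),
    isBasicModel_iff_of_isProgBased (hP _ Set.inter_subset_left) (hne _)]
  constructor
  · rintro ⟨I, hI, hDI⟩
    have hID : ∀ p ∈ I, p.pred ∈ D := fun p => pred_mem_of_isDynamicStableModel_layer hI
    have hcell : ∀ j, cyl (D ∩ τ ⁻¹' {j}) M = {J | restrLayer τ j I ⊆ J} := by
      intro j
      rw [← cyl_cyl (D := D) Set.inter_subset_left, hDI]
      ext J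
      constructor
      · rintro ⟨K, hK, hKJ⟩ p hp
        exact (hKJ p ⟨hID p hp.1, hp.2⟩).1 (hK hp.1)
      · intro hJ
        -- Adding `I` to `J` changes nothing on the cell, where `J` already contains `I`.
        refine ⟨I ∪ J, Set.subset_union_left, fun p hp => ⟨?_, Or.inr⟩⟩
        rintro (h | h)
        · exact hJ ⟨h, hp.2⟩
        · exact h
    refine ⟨?_, fun j => ⟨restrLayer τ j I, ?_, hcell j⟩⟩
    · rw [hDI]
      simp only [hcell]
      ext J
      rw [Set.mem_iInter]
      exact ⟨fun h j p hp => h hp.1, fun h p hp => h (τ p.pred) ⟨hp, rfl⟩⟩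
    · rw [prog_layer_cell fun p hp => forall_mem_iff_of_cyl_eq_upper hDI hp]
      exact hI.progCell j
  · rintro ⟨hprod, hcell⟩
    choose I hI hcell using hcell
    have hIj : ∀ j, restrLayer τ j (⋃ j, I j) = I j := by
      intro j
      ext p
      constructor
      · rintro ⟨hp, hj⟩
        obtain ⟨k, hk⟩ := Set.mem_iUnion.1 hp
        have := (pred_mem_of_isDynamicStableModel_layer (hI k) hk).2
        exact (show k = j from this.symm.trans hj) ▸ hk
      · exact fun hp => ⟨Set.mem_iUnion.2 ⟨j, hp⟩,
          (pred_mem_of_isDynamicStableModel_layer (hI j) hp).2⟩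
    have hDI : cyl D M = {J | ⋃ j, I j ⊆ J} := by
      rw [hprod]
      ext J
      simp only [hcell, Set.mem_iInter, Set.mem_ofPred_eq, Set.iUnion_subset_iff]
    refine ⟨⋃ j, I j, (isDynamicStableModel_iff_progCell hQ).2 fun j => ?_, hDI⟩
    rw [hIj, ← prog_layer_cell fun p hp => forall_mem_iff_of_cyl_eq_upper hDI hp]
    exact hI j

end Refine

/-! ### Stratifications -/

/-- The layers of `ρ` split `kb` into parts to which an update semantics applies. -/
structure IsStratification {ι : Type*} [LinearOrder ι] (kb : DynamicKB L n)
    (ρ : σ.Pred → ι) : Prop where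
  ont : ∀ i, ∀ a ∈ (kb i).ont, ∀ P ∈ L.preds a, ∀ Q ∈ L.preds a, ρ P = ρ Q
  prog : ∀ i, ∀ r ∈ (kb i).prog, ∀ K ∈ r.body, ρ K.pred ≤ ρ r.head.pred
  reducible : ∀ α,
    (∀ i, ∀ r ∈ (kb i).prog, ρ r.head.pred = α →
      r.IsPositive ∧ ∀ K ∈ r.body, ρ K.pred ≠ α) ∨
    ∀ i, ∀ a ∈ (kb i).ont, ¬ L.preds a ⊆ ρ ⁻¹' {α}

/-- `M` is the product of its projections to the layers of `ρ`, and these are models of the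
respective parts of `kb`. -/
def IsStratifiedModel {ι : Type*} (kb : DynamicKB L n) (ρ : σ.Pred → ι)
    (M : Set (Interp σ)) : Prop :=
  M.Nonempty ∧ M = ⋂ α, cyl (ρ ⁻¹' {α}) M ∧ ∀ α, kb.IsLocalModel (ρ ⁻¹' {α}) M

/-- Each layer of `ρ` is cut by `τ`. The kind of the layer selects the splitting theorem, and `τ`
supplies the cut. The resulting condition is symmetric in the two stratifications up to exchanging
the indices. -/
theorem isStratifiedModel_iff_refine {ι κ : Type*} [LinearOrder ι] [LinearOrder κ]
    [WellFoundedLT κ] {ρ : σ.Pred → ι} {τ : σ.Pred → κ} (hρ : kb.IsStratification ρ)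
    (hτ : kb.IsStratification τ) :
    kb.IsStratifiedModel ρ M ↔ M.Nonempty ∧
      M = ⋂ α, ⋂ β, cyl (ρ ⁻¹' {α} ∩ τ ⁻¹' {β}) M ∧
      ∀ α β, kb.IsLocalModel (ρ ⁻¹' {α} ∩ τ ⁻¹' {β}) M := by
  refine and_congr_right fun hM => ?_
  have href : ∀ α, kb.IsLocalModel (ρ ⁻¹' {α}) M ↔
      cyl (ρ ⁻¹' {α}) M = ⋂ β, cyl (ρ ⁻¹' {α} ∩ τ ⁻¹' {β}) M ∧
      ∀ β, kb.IsLocalModel (ρ ⁻¹' {α} ∩ τ ⁻¹' {β}) M := fun α =>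
    (hρ.reducible α).elim (fun h => isLocalModel_iff_refine_of_ont hτ.ont h hM)
      fun h => isLocalModel_iff_refine_of_prog hτ.prog h hM
  constructor
  · rintro ⟨hprod, hloc⟩
    refine ⟨?_, fun α β => ((href α).1 (hloc α)).2 β⟩
    conv_lhs => rw [hprod]
    exact Set.iInter_congr fun α => ((href α).1 (hloc α)).1
  · rintro ⟨hprod, hloc⟩
    have hcell : ∀ α, cyl (ρ ⁻¹' {α}) M = ⋂ β, cyl (ρ ⁻¹' {α} ∩ τ ⁻¹' {β}) M := by
      intro α
      apply Set.Subset.antisymm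
      · exact Set.subset_iInter fun β => cyl_anti Set.inter_subset_left M
      · intro J hJ
        obtain ⟨K, hK⟩ := hM
        -- A member of `M` completes `J` outside the layer, and the global product formula places
        -- the result in `M`.
        refine ⟨glue (ρ ⁻¹' {α}) J K, ?_, fun p hp => mem_glue_of_mem hp⟩
        rw [hprod]
        refine Set.mem_iInter.2 fun γ => Set.mem_iInter.2 fun β => ?_
        by_cases hγ : γ = α
        · subst hγ
          exact isCyl_cyl _ _ J _ (fun p hp => (mem_glue_of_mem hp.1).symm)
            (Set.mem_iInter.1 hJ β)
        · exact isCyl_cyl _ _ K _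
            (fun p hp => (mem_glue_of_notMem fun h => hγ (hp.1.symm.trans h)).symm)
            (subset_cyl _ _ hK)
    refine ⟨?_, fun α => (href α).2 ⟨hcell α, hloc α⟩⟩
    conv_lhs => rw [hprod]
    exact (Set.iInter_congr hcell).symm

theorem isStratifiedModel_iff {ι κ : Type*} [LinearOrder ι] [WellFoundedLT ι] [LinearOrder κ]
    [WellFoundedLT κ] {ρ : σ.Pred → ι} {τ : σ.Pred → κ} (hρ : kb.IsStratification ρ)
    (hτ : kb.IsStratification τ) : kb.IsStratifiedModel ρ M ↔ kb.IsStratifiedModel τ M := by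
  rw [isStratifiedModel_iff_refine hρ hτ, isStratifiedModel_iff_refine hτ hρ, Set.iInter_comm,
    forall_comm]
  simp only [Set.inter_comm]

end DynamicKB

/-! ### The stratification of an update-enabling splitting sequence -/

/-- The first index of a member of `U` that contains `P`. -/
noncomputable def PredSeq.rank (U : PredSeq.{u, v, o} σ) (P : σ.Pred) : Ordinal.{o} :=
  sInf {α | P ∈ U.set α}

namespace HybridKB.IsSplittingSequence

variable {K : HybridKB L} {U : PredSeq.{u, v, o} σ}

theorem rank_lt_and_mem (h : K.IsSplittingSequence U) (P : σ.Pred) :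
    U.rank P < U.length ∧ P ∈ U.set (U.rank P) := by
  have hP : P ∈ ⋃ α < U.length, U.set α := h.union ▸ Set.mem_univ P
  simp only [Set.mem_iUnion, exists_prop] at hP
  obtain ⟨α, hα, hP⟩ := hP
  exact ⟨(csInf_le' (s := {α | P ∈ U.set α}) hP).trans_lt hα, csInf_mem (s := {α | P ∈ U.set α}) ⟨α, hP⟩⟩

theorem mem_iff_rank_le (h : K.IsSplittingSequence U) {P : σ.Pred} {α : Ordinal.{o}}
    (hα : α < U.length) : P ∈ U.set α ↔ U.rank P ≤ α :=
  ⟨fun hP => csInf_le' hP, fun hP => h.monotone _ _ hP hα (h.rank_lt_and_mem P).2⟩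

/-- By continuity, a symbol present at a limit index has entered before it. -/
theorem not_isSuccLimit_rank (h : K.IsSplittingSequence U) (P : σ.Pred) :
    ¬ Order.IsSuccLimit (U.rank P) := by
  intro hlim
  have hP := (h.rank_lt_and_mem P).2
  rw [h.continuous _ (h.rank_lt_and_mem P).1 hlim] at hP
  simp only [Set.mem_iUnion, exists_prop] at hP
  obtain ⟨η, hη, hP⟩ := hP
  exact hη.not_ge (csInf_le' hP)

theorem rank_le_of_mem_preds (h : K.IsSplittingSequence U) {a : L.Ax} (ha : a ∈ K.ont)
    {P Q : σ.Pred} (hP : P ∈ L.preds a) (hQ : Q ∈ L.preds a) : U.rank Q ≤ U.rank P := by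
  obtain ⟨hlt, hmem⟩ := h.rank_lt_and_mem P
  exact (h.mem_iff_rank_le hlt).1 ((h.splitting _ hlt).1 a ha ⟨P, hP, hmem⟩ hQ)

theorem rank_le_of_mem_body (h : K.IsSplittingSequence U) {r : Rule σ} (hr : r ∈ K.prog)
    {H : Literal σ} (hH : H ∈ r.body) : U.rank H.pred ≤ U.rank r.head.pred := by
  obtain ⟨hlt, hmem⟩ := h.rank_lt_and_mem r.head.pred
  refine (h.mem_iff_rank_le hlt).1 ((h.splitting _ hlt).2 r hr
    ⟨_, by rw [r.head.preds_eq]; rfl, hmem⟩ (Or.inr ?_))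
  exact Set.mem_biUnion hH (by rw [H.preds_eq]; rfl)

theorem preds_subset_iff (h : K.IsSplittingSequence U) {r : Rule σ} (hr : r ∈ K.prog)
    {α : Ordinal.{o}} (hα : α < U.length) : r.preds ⊆ U.set α ↔ U.rank r.head.pred ≤ α := by
  constructor
  · intro hs
    exact (h.mem_iff_rank_le hα).1 (hs (Or.inl (by rw [r.head.preds_eq]; rfl)))
  · intro hs
    exact (h.splitting α hα).2 r hr
      ⟨_, by rw [r.head.preds_eq]; rfl, (h.mem_iff_rank_le hα).2 hs⟩

theorem ontPreds_subset_iff (h : K.IsSplittingSequence U) {a : L.Ax} (ha : a ∈ K.ont)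
    {P : σ.Pred} (hP : P ∈ L.preds a) {α : Ordinal.{o}} (hα : α < U.length) :
    L.preds a ⊆ U.set α ↔ U.rank P ≤ α :=
  ⟨fun hs => (h.mem_iff_rank_le hα).1 (hs hP),
    fun hs => (h.splitting α hα).1 a ha ⟨P, hP, (h.mem_iff_rank_le hα).2 hs⟩⟩

theorem ontPreds_subset_layer_iff (h : K.IsSplittingSequence U) {a : L.Ax} (ha : a ∈ K.ont)
    {P : σ.Pred} (hP : P ∈ L.preds a) {α : Ordinal.{o}} :
    L.preds a ⊆ U.rank ⁻¹' {α} ↔ U.rank P = α :=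
  ⟨fun hs => hs hP, fun hs _ hQ =>
    ((h.rank_le_of_mem_preds ha hP hQ).antisymm (h.rank_le_of_mem_preds ha hQ hP)).trans hs⟩

end HybridKB.IsSplittingSequence

theorem HybridKB.eq_of_ont_prog {K K' : HybridKB L} (ho : K.ont = K'.ont)
    (hp : K.prog = K'.prog) : K = K' := by
  cases K
  cases K'
  cases ho
  cases hp
  rfl

/-! ### Bottoms, reducts and reducibility in terms of layers. -/

namespace DynamicKB

variable {kb : DynamicKB L n} {U : PredSeq.{u, v, o} σ} {M : Set (Interp σ)}

/-- Rules with head of rank zero have bodies of rank zero, so nothing is evaluated in `M`, which is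
arbitrary. -/
theorem bottom_eq_layer (h : kb.IsSplittingSequence U) (h0 : 0 < U.length) :
    kb.bottom (U.set 0) = kb.layer (U.rank ⁻¹' {0}) M := by
  funext i
  have hset : U.set 0 = U.rank ⁻¹' {0} := by
    ext P
    rw [(h i).mem_iff_rank_le h0, nonpos_iff_eq_zero]
    rfl
  apply HybridKB.eq_of_ont_prog
  · simp only [bottom, HybridKB.bottom, layer, hset]
  · ext r'
    constructor
    · rintro ⟨hr, hs⟩
      have hb : ∀ K ∈ r'.body, K.pred ∈ U.rank ⁻¹' {0} := fun K hK =>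
        hset ▸ hs (Or.inr (Set.mem_biUnion hK (by rw [K.preds_eq]; rfl)))
      exact ⟨r', hr, hset ▸ hs (Or.inl (by rw [r'.head.preds_eq]; rfl)),
        fun K hK hn => (hn (hb K hK)).elim, rfl, fun K => (and_iff_left_of_imp (hb K)).symm⟩
    · rintro ⟨r, hr, hr0, -, hh, hb⟩
      obtain rfl : r' = r := by
        obtain ⟨H', B'⟩ := r'
        obtain ⟨H, B⟩ := r
        cases hh
        congr 1
        ext K
        rw [hb]
        refine and_iff_left_of_imp fun hK => ?_
        exact nonpos_iff_eq_zero.1 (((h i).rank_le_of_mem_body hr hK).trans hr0.le)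
      exact ⟨hr, ((h i).preds_subset_iff hr h0).2 hr0.le⟩

/-- The body literals that the reduct evaluates have rank at most `α`, so `X` may be exchanged for
any `M` that knows the same atoms of these ranks. -/
theorem reduct_eq_layer (h : kb.IsSplittingSequence U) {α : Ordinal.{o}}
    (hα : Order.succ α < U.length) {X : Set (Interp σ)} (hX : X.Nonempty)
    (hXM : ∀ p : GroundAtom σ, U.rank p.pred ≤ α → ((∀ J ∈ X, p ∈ J) ↔ ∀ J ∈ M, p ∈ J)) :
    (kb.bottom (U.set (Order.succ α))).reduct (U.set α) X =
      kb.layer (U.rank ⁻¹' {Order.succ α}) M := by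
  have hα' : α < U.length := (Order.lt_succ α).trans hα
  have hsucc : ∀ β : Ordinal.{o}, β = Order.succ α ↔ β ≤ Order.succ α ∧ ¬ β ≤ α := fun β => by
    rw [not_le, ← Order.succ_le_iff, le_antisymm_iff]
  funext i
  apply HybridKB.eq_of_ont_prog
  · ext a
    obtain ⟨P, hP⟩ := Formula.preds_nonempty (L.fo a).1
    change ((a ∈ (kb i).ont ∧ L.preds a ⊆ U.set (Order.succ α)) ∧
      ¬((a ∈ (kb i).ont ∧ L.preds a ⊆ U.set (Order.succ α)) ∧ L.preds a ⊆ U.set α)) ↔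
      a ∈ (kb i).ont ∧ L.preds a ⊆ U.rank ⁻¹' {Order.succ α}
    by_cases ha : a ∈ (kb i).ont
    · rw [(h i).ontPreds_subset_iff ha hP hα, (h i).ontPreds_subset_iff ha hP hα',
        (h i).ontPreds_subset_layer_iff ha hP, hsucc]
      tauto
    · tauto
  · ext r'
    change (∃ r, ((r ∈ (kb i).prog ∧ r.preds ⊆ U.set (Order.succ α)) ∧
        ¬((r ∈ (kb i).prog ∧ r.preds ⊆ U.set (Order.succ α)) ∧ r.preds ⊆ U.set α)) ∧
        Models X (Literal.toMKNF '' {K | K ∈ r.body ∧ K.preds ⊆ U.set α}) ∧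
        r'.head = r.head ∧ ∀ K, K ∈ r'.body ↔ K ∈ r.body ∧ K.preds ⊆ (U.set α)ᶜ) ↔
      ∃ r ∈ (kb i).prog, U.rank r.head.pred = Order.succ α ∧
        (∀ K ∈ r.body, U.rank K.pred ≠ Order.succ α → K.HoldsIn M) ∧
        r'.head = r.head ∧ ∀ K, K ∈ r'.body ↔ K ∈ r.body ∧ U.rank K.pred = Order.succ α
    refine exists_congr fun r => ?_
    by_cases hr : r ∈ (kb i).prog
    · rw [(h i).preds_subset_iff hr hα, (h i).preds_subset_iff hr hα', hsucc,
        models_toMKNF_iff hX]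
      simp only [hr, true_and]
      rw [show ∀ a b c : Prop, (a ∧ ¬(a ∧ b)) ∧ c ↔ (a ∧ ¬b) ∧ c by tauto]
      refine and_congr_right fun hrα => ?_
      have hK : ∀ K ∈ r.body, (U.rank K.pred = Order.succ α ↔ ¬ U.rank K.pred ≤ α) :=
        fun K hK => (hsucc _).trans
          (and_iff_right (((h i).rank_le_of_mem_body hr hK).trans hrα.1))
      refine and_congr ?_ (and_congr_right fun _ => forall_congr' fun K => ?_)
      · refine forall_congr' fun K => ?_
        rw [Set.mem_ofPred_eq, and_imp]
        refine forall_congr' fun hKb => ?_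
        rw [ne_eq, hK K hKb, not_not, Literal.preds_subset_iff, (h i).mem_iff_rank_le hα']
        refine forall_congr' fun hKα => Literal.holdsIn_congr fun p hp => ?_
        exact hXM p (hp ▸ hKα)
      · refine iff_congr Iff.rfl (and_congr_right fun hKb => ?_)
        rw [hK K hKb, Literal.preds_subset_iff, Set.mem_compl_iff,
          (h i).mem_iff_rank_le hα']
    · tauto

theorem IsUpdateEnabling.isStratification (h : kb.IsUpdateEnabling U) :
    kb.IsStratification U.rank where
  ont i a ha P hP Q hQ := (((h.splitting i).rank_le_of_mem_preds ha hQ hP)).antisymm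
    ((h.splitting i).rank_le_of_mem_preds ha hP hQ)
  prog i r hr K hK := (h.splitting i).rank_le_of_mem_body hr hK
  reducible α := by
    by_cases hα : α < U.length
    swap
    · exact Or.inl fun i r _ hrα =>
        (hα (hrα ▸ ((h.splitting i).rank_lt_and_mem r.head.pred).1)).elim
    have hbody : ∀ (r : Rule σ), ∀ K ∈ r.body, K.pred ∈ r.bodyPreds := fun r K hK =>
      Set.mem_biUnion hK (by rw [K.preds_eq]; rfl)
    rcases Ordinal.zero_or_succ_or_isSuccLimit α with rfl | ⟨β, rfl⟩ | hlim
    · rcases h.zero hα with hred | hred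
      · left
        intro i r hr hr0
        obtain ⟨hpos, hb⟩ := hred i r ⟨hr, ((h.splitting i).preds_subset_iff hr hα).2 hr0.le⟩
        exact ⟨hpos, fun K hK => (hb (hbody r K hK)).elim⟩
      · right
        intro i a ha hs
        obtain ⟨P, hP⟩ := Formula.preds_nonempty (L.fo a).1
        have : a ∈ (kb.bottom (U.set 0) i).ont :=
          ⟨ha, ((h.splitting i).ontPreds_subset_iff ha hP hα).2 (hs hP).le⟩
        rw [hred i] at this
        exact this
    · have hβ : β < U.length := (Order.lt_succ β).trans hα
      rcases h.succ β hα with hred | hred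
      · left
        intro i r hr hrα
        obtain ⟨hpos, hb⟩ := hred i r
          ⟨⟨hr, ((h.splitting i).preds_subset_iff hr hα).2 hrα.le⟩, fun hr' => by
            have := ((h.splitting i).preds_subset_iff hr hβ).1 hr'.2
            rw [hrα] at this
            exact this.not_gt (Order.lt_succ β)⟩
        refine ⟨hpos, fun K hK hKα => ?_⟩
        have := ((h.splitting i).mem_iff_rank_le hβ).1 (hb (hbody r K hK))
        rw [hKα] at this
        exact this.not_gt (Order.lt_succ β)
      · right
        intro i a ha hs
        obtain ⟨P, hP⟩ := Formula.preds_nonempty (L.fo a).1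
        have : a ∈ ((kb.bottom (U.set (Order.succ β))).top (U.set β) i).ont :=
          ⟨⟨ha, ((h.splitting i).ontPreds_subset_iff ha hP hα).2 (hs hP).le⟩, fun ha' => by
            have := ((h.splitting i).ontPreds_subset_iff ha hP hβ).1 ha'.2
            rw [show U.rank P = Order.succ β from hs hP] at this
            exact this.not_gt (Order.lt_succ β)⟩
        rw [hred i] at this
        exact this
    · exact Or.inl fun i r _ hrα =>
        ((h.splitting i).not_isSuccLimit_rank r.head.pred (hrα ▸ hlim)).elim

/-! ### Solutions as stratified models. -/

theorem IsSplittingSequence.layer_eq_empty_of_isSuccLimit [NeZero n]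
    (h : kb.IsSplittingSequence U) {α : Ordinal.{o}} (hα : Order.IsSuccLimit α) :
    U.rank ⁻¹' {α} = ∅ :=
  Set.eq_empty_of_forall_notMem fun P hP =>
    (h 0).not_isSuccLimit_rank P ((show U.rank P = α from hP) ▸ hα)

theorem IsSplittingSequence.layer_eq_empty_of_length_le [NeZero n]
    (h : kb.IsSplittingSequence U) {α : Ordinal.{o}} (hα : U.length ≤ α) :
    U.rank ⁻¹' {α} = ∅ :=
  Set.eq_empty_of_forall_notMem fun P hP =>
    (((h 0).rank_lt_and_mem P).1.trans_le hα).ne hP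

theorem IsSplittingSequence.iInter_cyl [NeZero n] (h : kb.IsSplittingSequence U)
    (hM : M.Nonempty) :
    ⋂ α < U.length, cyl (U.rank ⁻¹' {α}) M = ⋂ α, cyl (U.rank ⁻¹' {α}) M := by
  refine Set.iInter_congr fun α => ?_
  by_cases hα : α < U.length
  · simp [hα]
  · rw [h.layer_eq_empty_of_length_le (not_lt.1 hα), cyl_empty hM]
    simp [hα]

/-- The sets `X α` may be replaced by the projections of their intersection. -/
theorem IsSolution.eq_cyl [NeZero n] (h : kb.IsSplittingSequence U)
    {X : Ordinal.{o} → Set (Interp σ)} (hX : kb.IsSolution U X)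
    (hM : (⋂ α < U.length, X α).Nonempty) {α : Ordinal.{o}} (hα : α < U.length) :
    X α = cyl (U.rank ⁻¹' {α}) (⋂ α < U.length, X α) := by
  have hcyl : ∀ α : {α // α < U.length}, IsCyl (U.rank ⁻¹' {α.1}) (X α.1) := by
    rintro ⟨α, hα⟩
    rcases Ordinal.zero_or_succ_or_isSuccLimit α with rfl | ⟨β, rfl⟩ | hlim
    · have := hX.zero hα
      rw [bottom_eq_layer (M := Set.univ) h hα] at this
      exact this.isCyl (fun i a ha => ha.2) fun i r hr => head_mem_of_mem_layer hr
    · have := hX.succ β hα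
      have hne : (⋂ η ≤ β, X η).Nonempty := hM.mono
        (Set.subset_iInter₂ fun η hη => Set.iInter₂_subset (s := fun η (_ : η < U.length) => X η) η
          (hη.trans_lt ((Order.lt_succ β).trans hα)))
      -- The partial intersection itself serves as the evaluating set; only the symbols of the layer
      -- matter here.
      rw [reduct_eq_layer h hα hne fun _ _ => Iff.rfl] at this
      exact this.isCyl (fun i a ha => ha.2) fun i r hr => head_mem_of_mem_layer hr
    · rw [hX.limit α hα hlim]
      exact fun _ _ _ _ => trivial
  have hsub : (⋂ α < U.length, X α) = ⋂ α : {α // α < U.length}, X α.1 := by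
    rw [Set.iInter_subtype]
  rw [hsub] at hM ⊢
  exact (cyl_iInter (fun P β γ hβ hγ => Subtype.ext (hβ.symm.trans hγ)) hcyl hM ⟨α, hα⟩).symm

/-- The sequence `X` is forced to consist of the projections of `M`, so the recursive conditions on
`X` become independent conditions on `M`. -/
theorem isDynamicModelWrt_iff_isStratifiedModel [NeZero n] (h : kb.IsSplittingSequence U) :
    kb.IsDynamicModelWrt U M ↔ kb.IsStratifiedModel U.rank M := by
  have hred : ∀ X : Ordinal.{o} → Set (Interp σ), M.Nonempty →
      (∀ α < U.length, X α = cyl (U.rank ⁻¹' {α}) M) → ∀ α, Order.succ α < U.length →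
      (kb.bottom (U.set (Order.succ α))).reduct (U.set α) (⋂ η ≤ α, X η) =
        kb.layer (U.rank ⁻¹' {Order.succ α}) M := by
    intro X hM hX α hα
    have hα' : ∀ η ≤ α, η < U.length := fun η hη => hη.trans_lt ((Order.lt_succ α).trans hα)
    have hsub : M ⊆ ⋂ η ≤ α, X η := Set.subset_iInter₂ fun η hη => by
      rw [hX η (hα' η hη)]
      exact subset_cyl _ _
    refine reduct_eq_layer h hα (hM.mono hsub) fun p hp =>
      -- The partial intersection lies between `M` and the projection of `M` to the layer of `p`,
      -- hence knows `p` iff `M` does.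
      forall_mem_iff_of_subset_cyl (C := U.rank ⁻¹' {U.rank p.pred}) hsub ?_ rfl
    rw [← hX _ (hα' _ hp)]
    exact Set.iInter₂_subset (U.rank p.pred) hp
  constructor
  · rintro ⟨hM, X, hX, hMX⟩
    have hXM : ∀ α < U.length, X α = cyl (U.rank ⁻¹' {α}) M := fun α hα => by
      rw [hMX] at hM ⊢
      exact hX.eq_cyl h hM hα
    refine ⟨hM, ?_, fun α => ?_⟩
    · rw [← h.iInter_cyl hM]
      conv_lhs => rw [hMX]
      exact Set.iInter₂_congr hXM
    · by_cases hα : α < U.length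
      swap
      · rw [h.layer_eq_empty_of_length_le (not_lt.1 hα)]
        exact isLocalModel_empty hM
      rcases Ordinal.zero_or_succ_or_isSuccLimit α with rfl | ⟨β, rfl⟩ | hlim
      · rw [IsLocalModel, ← bottom_eq_layer h hα, ← hXM 0 hα]
        exact hX.zero hα
      · rw [IsLocalModel, ← hred X hM hXM β hα, ← hXM _ hα]
        exact hX.succ β hα
      · rw [h.layer_eq_empty_of_isSuccLimit hlim]
        exact isLocalModel_empty hM
  · rintro ⟨hM, hprod, hloc⟩
    refine ⟨hM, fun α => cyl (U.rank ⁻¹' {α}) M, ⟨fun α _ => hM.mono (subset_cyl _ _), ?_, ?_, ?_⟩,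
      hprod.trans (h.iInter_cyl hM).symm⟩
    · intro h0
      rw [bottom_eq_layer h h0]
      exact hloc 0
    · intro α hα
      rw [hred _ hM (fun _ _ => rfl) α hα]
      exact hloc _
    · intro α _ hlim
      rw [h.layer_eq_empty_of_isSuccLimit hlim, cyl_empty hM]

/-- The empty sequence of knowledge bases has the single model `𝓘`. -/
theorem isDynamicModelWrt_iff_eq_univ {kb : DynamicKB L 0} :
    kb.IsDynamicModelWrt U M ↔ M = Set.univ := by
  have hbasic : ∀ (kb : DynamicKB L 0) (X : Set (Interp σ)),
      kb.IsBasicModel X ↔ X = Set.univ := by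
    intro kb X
    have hiff : ∀ X : Set (Interp σ), X.Nonempty → (kb.IsBasicModel X ↔ X = Set.univ) :=
      fun X hX => by
        rw [isBasicModel_iff_of_isOntBased (fun i => i.elim0) hX]
        rfl
    exact ⟨fun hX => (hiff X hX.1).1 hX, fun hX => (hiff X (hX ▸ Set.univ_nonempty)).2 hX⟩
  constructor
  · rintro ⟨-, X, hX, rfl⟩
    refine Set.iInter_eq_univ.2 fun α => Set.iInter_eq_univ.2 fun hα => ?_
    rcases Ordinal.zero_or_succ_or_isSuccLimit α with rfl | ⟨β, rfl⟩ | hlim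
    · exact (hbasic _ _).1 (hX.zero hα)
    · exact (hbasic _ _).1 (hX.succ β hα)
    · exact hX.limit α hα hlim
  · rintro rfl
    exact ⟨Set.univ_nonempty, fun _ => Set.univ,
      ⟨fun _ _ => Set.univ_nonempty, fun _ => (hbasic _ _).2 rfl, fun _ _ => (hbasic _ _).2 rfl,
        fun _ _ _ => rfl⟩, by simp⟩

theorem IsUpdateEnabling.isDynamicModelWrt_iff {V : PredSeq.{u, v, o'} σ}
    (hU : kb.IsUpdateEnabling U) (hV : kb.IsUpdateEnabling V) :
    kb.IsDynamicModelWrt U M ↔ kb.IsDynamicModelWrt V M := by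
  cases n with
  -- Without component knowledge bases the splitting conditions are vacuous, so the sequence need
  -- not exhaust the symbols and the rank is of no use.
  | zero => rw [isDynamicModelWrt_iff_eq_univ, isDynamicModelWrt_iff_eq_univ]
  | succ n =>
    rw [isDynamicModelWrt_iff_isStratifiedModel hU.splitting,
      isDynamicModelWrt_iff_isStratifiedModel hV.splitting,
      isStratifiedModel_iff hU.isStratification hV.isStratification]

end DynamicKB

end HybridMKNF

theorem mainTheorem3 {σ : HybridMKNF.Signature.{u, v}}
    {L : HybridMKNF.DescriptionLogic.{u, v, w} σ} {n : ℕ} (kb : HybridMKNF.DynamicKB L n)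
    (U : HybridMKNF.PredSeq.{u, v, o} σ) (V : HybridMKNF.PredSeq.{u, v, o'} σ)
    (hU : kb.IsUpdateEnabling U) (hV : kb.IsUpdateEnabling V) :
    (∀ M : Set (HybridMKNF.Interp σ), kb.IsDynamicModelWrt U M ↔ kb.IsDynamicModelWrt V M) ∧
      ∀ M : Set (HybridMKNF.Interp σ),
        HybridMKNF.DynamicKB.IsDynamicModel.{u, v, w, o} kb M ↔ kb.IsDynamicModelWrt U M := by
  refine ⟨fun M => hU.isDynamicModelWrt_iff hV, fun M => ⟨?_, fun h => ⟨U, hU, h⟩⟩⟩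
  rintro ⟨W, hW, hM⟩
  exact (hW.isDynamicModelWrt_iff hU).1 hM
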